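/- **Setting.** Let $N,K\in\mathbb{N}$, let $b\in\mathbb{R}^N$ have strictly positive entries with $\sum_i b_i=1$, let $x_1,\dots,x_N\in\mathbb{R}^K$, and let $t$ lie in the relative interior of $\mathrm{conv}\{x_1,\dots,x_N\}$. For $\theta\in\mathbb{R}^K$ put $$L(\theta)=\theta^\top t-\log\sum_i b_i e^{\theta^\top x_i},\qquad w_i(\theta)=\frac{b_i e^{\theta^\top x_i}}{\sum_j b_j e^{\theta^\top x_j}},$$ $$\mu(\theta)=\sum_i w_i(\theta)x_i,\qquad g(\theta)=t-\mu(\theta),\qquad \Sigma(\theta)=\mathrm{Cov}_{w(\theta)}(x)=\sum_i w_i(\theta)(x_i-\mu(\theta))(x_i-\mu(\theta))^\top .$$ Fix $0<c<\tfrac12$ and $0<\beta<1$. A *damped Newton run* with ridge parameters $\delta_k\ge 0$ is a sequence $(\theta_k)_{k\ge0}$ with arbitrary starting point $\theta_0\in\mathbb{R}^K$ and $\theta_{k+1}=\theta_k+\alpha_k\Delta_k$, where $\Delta_k$ is a solution of $$(\Sigma(\theta_k)+\delta_k I)\,\Delta_k=g(\theta_k)$$ and $\alpha_k$ is the largest element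 of $\{\beta^j: j=0,1,2,\dots\}$ with $L(\theta_k+\alpha_k\Delta_k)\ge L(\theta_k)+c\,\alpha_k\,g(\theta_k)^\top\Delta_k$. **Theorem (Convergence of EGMU-Newton).** 1. *(Well-posedness.)* $L$ attains its maximum on $\mathbb{R}^K$. For every $\theta\in\mathbb{R}^K$ and $\delta\ge0$ the system $(\Sigma(\theta)+\delta I)\Delta=g(\theta)$ has a solution, and for every solution $\Delta$ there is $j\ge 0$ for which $\alpha=\beta^j$ satisfies the Armijo condition $L(\theta+\alpha\Delta)\ge L(\theta)+c\,\alpha\,g(\theta)^\top\Delta$. 2. *(Global convergence.)* For every damped Newton run with bounded ridge parameters $\delta_k\ge0$: $L(\theta_k)$ is nondecreasing, $\nabla L(\theta_k)\to0$, $\mu(\theta_k)\to t$, and for every maximizer $\theta^\star$ of $L$, $L(\theta_k)\to L(\theta^\star)$ and $w(\theta_k)\to w(\theta^\star)$; moreover the distance of $\theta_k$ to the set of maximizers of $L$ tends to $0$. If in addition $\Delta_k\in\mathrm{range}\,\Sigma(\theta_k)$ for every $k$ (which excludes only a freedom that exists when $\delta_k=0$ and $\Sigma(\theta_k)$ is singular),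 then $\theta_k$ converges to a maximizer of $L$. 3. *(Local quadratic convergence.)* Let $\theta^\star$ be a maximizer of $L$, and suppose that there are a neighbourhood $U$ of $\theta^\star$ and constants $m>0$, $M\ge0$ such that $\Sigma(\theta)\succeq mI$ for all $\theta\in U$ and $\nabla^2L$ is $M$-Lipschitz on $U$ (in operator norm). Then: - there is $r>0$ such that every damped Newton run with $\delta_k=0$ for all $k$ and $\|\theta_0-\theta^\star\|_2<r$ converges to $\theta^\star$ and satisfies, for all $k\ge0$, $\alpha_k=1$ and $$\|\theta_{k+1}-\theta^\star\|_2\le\frac{M}{2m}\,\|\theta_k-\theta^\star\|_2^2;$$ - every damped Newton run (with arbitrary $\theta_0$) with bounded $\delta_k\ge0$ and $\delta_k=0$ for all sufficiently large $k$ converges to $\theta^\star$, and $\alpha_k=1$ and the same quadratic estimate hold for all sufficiently large $k$. -/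

import Mathlib

open Set Filter Topology
open scoped NNReal Matrix Gradient

noncomputable section

/-- The partition function `Z(θ) = ∑ᵢ bᵢ exp(θᵀ xᵢ)`. Here `b` is the prior and `x i` is the
`i`-th row of the exposure matrix. -/
def partitionFn {N K : ℕ} (b : Fin N → ℝ) (x : Fin N → EuclideanSpace ℝ (Fin K))
    (θ : EuclideanSpace ℝ (Fin K)) : ℝ :=
  ∑ i, b i * Real.exp (inner ℝ θ (x i))

/-- The exponential tilt `wᵢ(θ) = bᵢ exp(θᵀ xᵢ) / ∑ⱼ bⱼ exp(θᵀ xⱼ)`. -/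
def tilt {N K : ℕ} (b : Fin N → ℝ) (x : Fin N → EuclideanSpace ℝ (Fin K))
    (θ : EuclideanSpace ℝ (Fin K)) : Fin N → ℝ :=
  fun i => b i * Real.exp (inner ℝ θ (x i)) / partitionFn b x θ

/-- The dual objective `L(θ) = θᵀ t - log ∑ᵢ bᵢ exp(θᵀ xᵢ)`. -/
def dualObj {N K : ℕ} (b : Fin N → ℝ) (x : Fin N → EuclideanSpace ℝ (Fin K))
    (t θ : EuclideanSpace ℝ (Fin K)) : ℝ :=
  inner ℝ θ t - Real.log (partitionFn b x θ)

/-- The mean `E_w[x] = ∑ᵢ wᵢ xᵢ`. -/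
def wMean {N K : ℕ} (w : Fin N → ℝ) (x : Fin N → EuclideanSpace ℝ (Fin K)) :
    EuclideanSpace ℝ (Fin K) :=
  ∑ i, w i • x i

/-- The covariance matrix `Cov_w(x) = ∑ᵢ wᵢ (xᵢ - μ)(xᵢ - μ)ᵀ` with `μ = E_w[x]`. -/
def wCov {N K : ℕ} (w : Fin N → ℝ) (x : Fin N → EuclideanSpace ℝ (Fin K)) :
    Matrix (Fin K) (Fin K) ℝ :=
  ∑ i, w i • Matrix.vecMulVec (fun j => (x i - wMean w x) j) (fun j => (x i - wMean w x) j)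

/-- The residual `g(θ) = t - E_{w(θ)}[x]` used by the algorithm. -/
def dualResidual {N K : ℕ} (b : Fin N → ℝ) (x : Fin N → EuclideanSpace ℝ (Fin K))
    (t θ : EuclideanSpace ℝ (Fin K)) : EuclideanSpace ℝ (Fin K) :=
  t - wMean (tilt b x θ) x

/-- `Δ` is a (ridge-regularized) Newton direction at `θ`: `(Cov_{w(θ)}(x) + δ I) Δ = g(θ)`. -/
def IsNewtonDir {N K : ℕ} (b : Fin N → ℝ) (x : Fin N → EuclideanSpace ℝ (Fin K))
    (t : EuclideanSpace ℝ (Fin K)) (δ : ℝ) (θ Δ : EuclideanSpace ℝ (Fin K)) : Prop :=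
  Matrix.toEuclideanLin (wCov (tilt b x θ) x + δ • (1 : Matrix (Fin K) (Fin K) ℝ)) Δ =
    dualResidual b x t θ

/-- The Armijo condition `L(θ + α Δ) ≥ L(θ) + c α gᵀΔ`. -/
def Armijo {N K : ℕ} (b : Fin N → ℝ) (x : Fin N → EuclideanSpace ℝ (Fin K))
    (t : EuclideanSpace ℝ (Fin K)) (c : ℝ) (θ Δ : EuclideanSpace ℝ (Fin K)) (α : ℝ) : Prop :=
  dualObj b x t θ + c * α * inner ℝ (dualResidual b x t θ) Δ ≤ dualObj b x t (θ + α • Δ)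

/-- A run of damped Newton ascent with Armijo backtracking: `θ k` are the iterates, `δ k` the
ridge parameters, `Δ k` the search directions, and `β ^ n k` the step lengths, where `n k` is
the number of backtracking steps, so that `β ^ n k` is the largest power of `β` that satisfies
the Armijo condition. -/
structure IsNewtonRun {N K : ℕ} (b : Fin N → ℝ) (x : Fin N → EuclideanSpace ℝ (Fin K))
    (t : EuclideanSpace ℝ (Fin K)) (c β : ℝ) (δ : ℕ → ℝ)
    (θ Δ : ℕ → EuclideanSpace ℝ (Fin K)) (n : ℕ → ℕ) : Prop where
  dir : ∀ k, IsNewtonDir b x t (δ k) (θ k) (Δ k)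
  search : ∀ k, IsLeast {j : ℕ | Armijo b x t c (θ k) (Δ k) (β ^ j)} (n k)
  step : ∀ k, θ (k + 1) = θ k + β ^ n k • Δ k

end

/-!
The residual `g` is the gradient of the concave function `L`, and its derivative is `-Σ`. Both `L`
and `Σ` ignore the component of `θ` orthogonal to the direction `V` of the affine span of the
points, so a run may be projected orthogonally onto `V`. There `L` has compact superlevel sets,
because `t` is a relative interior point of the convex hull, and `Σ` is uniformly positive definite
on each of them. Backtracking then keeps the step lengths away from `0`, and since `L (θ k)`
increases and is bounded above, `Δ k → 0` and `g (θ k) → 0`; compactness gives convergence of the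
projected run to the unique maximizer in `V`. Near a nondegenerate maximizer, Taylor's formula shows
that the Newton step contracts quadratically and that the unit step passes the Armijo test, because
the predicted gain is about `(1 / 2) gᵀΔ` and `c < 1 / 2`.
-/

/-! ### Taylor estimates -/

section Taylor

variable {E F : Type*} [NormedAddCommGroup E]

section Normed

variable [NormedSpace ℝ E] [NormedAddCommGroup F] [NormedSpace ℝ F]

theorem hasDerivAt_comp_add_smul {G : E → F} {L : E →L[ℝ] F} {y d : E} {r : ℝ}
    (hG : HasFDerivAt G L (y + r • d)) : HasDerivAt (fun r : ℝ ↦ G (y + r • d)) (L d) r := by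
  have hline : HasDerivAt (fun r : ℝ ↦ y + r • d) d r := by
    simpa using ((hasDerivAt_id r).smul_const d).const_add y
  exact hG.comp_hasDerivAt r hline

theorem norm_image_add_sub_sub_le_of_lipschitzOnWith {G : E → F} {G' : E → E →L[ℝ] F} {s : Set E}
    (hs : Convex ℝ s) (hG : ∀ y ∈ s, HasFDerivAt G (G' y) y) {M : ℝ≥0}
    (hM : LipschitzOnWith M G' s) {y d : E} (hy : y ∈ s) (hyd : y + d ∈ s) :
    ‖G (y + d) - G y - G' y d‖ ≤ M / 2 * ‖d‖ ^ 2 := by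
  have hseg : ∀ r ∈ Icc (0 : ℝ) 1, y + r • d ∈ s := fun r hr ↦ hs.add_smul_mem hy hyd hr
  have hremainder : ∀ r ∈ Icc (0 : ℝ) 1, HasDerivAt
      (fun r : ℝ ↦ G (y + r • d) - G y - r • G' y d) (G' (y + r • d) d - G' y d) r := fun r hr ↦ by
    simpa using ((hasDerivAt_comp_add_smul (hG _ (hseg r hr))).sub_const (G y)).fun_sub
      ((hasDerivAt_id r).smul_const (G' y d))
  have hbound : ∀ r : ℝ, HasDerivAt (fun r : ℝ ↦ M / 2 * ‖d‖ ^ 2 * r ^ 2) (M * ‖d‖ ^ 2 * r) r :=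
    fun r ↦ ((hasDerivAt_pow 2 r).const_mul _).congr_deriv (by norm_num; ring)
  have hderiv_le : ∀ r ∈ Ico (0 : ℝ) 1, ‖G' (y + r • d) d - G' y d‖ ≤ M * ‖d‖ ^ 2 * r := by
    intro r hr
    calc ‖G' (y + r • d) d - G' y d‖ = ‖(G' (y + r • d) - G' y) d‖ := rfl
      _ ≤ ‖G' (y + r • d) - G' y‖ * ‖d‖ := ContinuousLinearMap.le_opNorm _ _
      _ ≤ M * ‖y + r • d - y‖ * ‖d‖ := by
        gcongr
        exact hM.norm_sub_le (hseg r ⟨hr.1, hr.2.le⟩) hy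
      _ = M * ‖d‖ ^ 2 * r := by
        rw [add_sub_cancel_left, norm_smul, Real.norm_of_nonneg hr.1]; ring
  simpa using image_norm_le_of_norm_deriv_right_le_deriv_boundary
    (fun r hr ↦ (hremainder r hr).continuousAt.continuousWithinAt)
    (fun r hr ↦ (hremainder r ⟨hr.1, hr.2.le⟩).hasDerivWithinAt) (by simp) hbound hderiv_le
    (right_mem_Icc.2 zero_le_one)

theorem norm_newton_step_sub_zero_le {G : E → F} {G' : E → E →L[ℝ] F} {s : Set E}
    (hs : Convex ℝ s) (hG : ∀ y ∈ s, HasFDerivAt G (G' y) y) {M : ℝ≥0}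
    (hM : LipschitzOnWith M G' s) {θ θs Δ : E} (hθ : θ ∈ s) (hθs : θs ∈ s) (hzero : G θs = 0)
    {m : ℝ} (hm : 0 < m) (hbelow : ∀ v, m * ‖v‖ ≤ ‖G' θ v‖) (hΔ : G' θ Δ = -G θ) :
    ‖θ + Δ - θs‖ ≤ M / (2 * m) * ‖θ - θs‖ ^ 2 := by
  have htaylor := norm_image_add_sub_sub_le_of_lipschitzOnWith hs hG hM (d := θs - θ) hθ
    (by rwa [add_sub_cancel])
  have herror : G (θ + (θs - θ)) - G θ - G' θ (θs - θ) = G' θ (θ + Δ - θs) := by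
    rw [add_sub_cancel, hzero, zero_sub, ← hΔ, ← map_sub]
    congr 1
    abel
  rw [herror, norm_sub_rev] at htaylor
  calc ‖θ + Δ - θs‖ ≤ M / 2 * ‖θ - θs‖ ^ 2 / m :=
        (le_div_iff₀' hm).2 ((hbelow _).trans htaylor)
    _ = M / (2 * m) * ‖θ - θs‖ ^ 2 := by field_simp

end Normed

variable [InnerProductSpace ℝ E] [CompleteSpace E] {f : E → ℝ} {g : E → E}

theorem abs_sub_sub_inner_le_of_lipschitzWith (hf : ∀ y, HasGradientAt f (g y) y) {Λ : ℝ≥0}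
    (hg : LipschitzWith Λ g) (y d : E) :
    |f (y + d) - f y - inner ℝ (g y) d| ≤ Λ / 2 * ‖d‖ ^ 2 := by
  have hdual : LipschitzOnWith Λ (fun y ↦ InnerProductSpace.toDual ℝ E (g y)) univ :=
    LipschitzOnWith.of_dist_le_mul fun y _ z _ ↦
      ((InnerProductSpace.toDual ℝ E).dist_map _ _).trans_le (hg.dist_le_mul y z)
  simpa using norm_image_add_sub_sub_le_of_lipschitzOnWith convex_univ
    (fun y _ ↦ (hf y).hasFDerivAt) hdual (mem_univ y) (mem_univ (y + d))

theorem abs_sub_sub_inner_sub_half_inner_le_of_lipschitzOnWith {g' : E → E →L[ℝ] E} {s : Set E}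
    (hs : Convex ℝ s) (hf : ∀ y ∈ s, HasGradientAt f (g y) y)
    (hg : ∀ y ∈ s, HasFDerivAt g (g' y) y) {M : ℝ≥0} (hM : LipschitzOnWith M g' s) {y d : E}
    (hy : y ∈ s) (hyd : y + d ∈ s) :
    |f (y + d) - f y - inner ℝ (g y) d - 1 / 2 * inner ℝ (g' y d) d| ≤ M / 6 * ‖d‖ ^ 3 := by
  have hseg : ∀ r ∈ Icc (0 : ℝ) 1, y + r • d ∈ s := fun r hr ↦ hs.add_smul_mem hy hyd hr
  have hremainder : ∀ r ∈ Icc (0 : ℝ) 1, HasDerivAt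
      (fun r : ℝ ↦ f (y + r • d) - f y - r * inner ℝ (g y) d - r ^ 2 / 2 * inner ℝ (g' y d) d)
      (inner ℝ (g (y + r • d) - g y - r • g' y d) d) r := fun r hr ↦ by
    refine ((((hasDerivAt_comp_add_smul (hf _ (hseg r hr)).hasFDerivAt).sub_const (f y)).sub
      ((hasDerivAt_id r).mul_const _)).sub
      (((hasDerivAt_pow 2 r).div_const 2).mul_const _)).congr_deriv ?_
    simp [inner_sub_left, inner_smul_left]
  have hbound : ∀ r : ℝ,
      HasDerivAt (fun r : ℝ ↦ M / 6 * ‖d‖ ^ 3 * r ^ 3) (M / 2 * ‖d‖ ^ 3 * r ^ 2) r :=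
    fun r ↦ ((hasDerivAt_pow 3 r).const_mul _).congr_deriv (by norm_num; ring)
  have hderiv_le : ∀ r ∈ Ico (0 : ℝ) 1,
      ‖inner ℝ (g (y + r • d) - g y - r • g' y d) d‖ ≤ M / 2 * ‖d‖ ^ 3 * r ^ 2 := by
    intro r hr
    calc ‖inner ℝ (g (y + r • d) - g y - r • g' y d) d‖
        ≤ ‖g (y + r • d) - g y - r • g' y d‖ * ‖d‖ := norm_inner_le_norm _ _
      _ ≤ M / 2 * ‖r • d‖ ^ 2 * ‖d‖ := by
        gcongr
        simpa using norm_image_add_sub_sub_le_of_lipschitzOnWith hs hg hM hy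
          (hseg r ⟨hr.1, hr.2.le⟩)
      _ = M / 2 * ‖d‖ ^ 3 * r ^ 2 := by rw [norm_smul, Real.norm_of_nonneg hr.1]; ring
  simpa using image_norm_le_of_norm_deriv_right_le_deriv_boundary
    (fun r hr ↦ (hremainder r hr).continuousAt.continuousWithinAt)
    (fun r hr ↦ (hremainder r ⟨hr.1, hr.2.le⟩).hasDerivWithinAt) (by simp) hbound hderiv_le
    (right_mem_Icc.2 zero_le_one)

end Taylor

/-! ### Ascent with Armijo backtracking -/

section Backtracking

variable {E : Type*} [NormedAddCommGroup E] [InnerProductSpace ℝ E]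

/-- The Armijo condition for the step `α • Δ` from `θ`, for an objective `f` whose gradient
field is `g`; it is passed separately so that no differentiability is built into the notion. -/
def SufficientIncrease (f : E → ℝ) (g : E → E) (c : ℝ) (θ Δ : E) (α : ℝ) : Prop :=
  f θ + c * α * inner ℝ (g θ) Δ ≤ f (θ + α • Δ)

/-- An ascent method with Armijo backtracking along arbitrary directions `Δ k`: the step length
is `β ^ n k`, where `n k` is the number of backtracking steps. -/
structure IsBacktrackingAscent (f : E → ℝ) (g : E → E) (c β : ℝ) (θ Δ : ℕ → E) (n : ℕ → ℕ) :
    Prop where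
  search : ∀ k, IsLeast {j : ℕ | SufficientIncrease f g c (θ k) (Δ k) (β ^ j)} (n k)
  step : ∀ k, θ (k + 1) = θ k + β ^ n k • Δ k

variable {f : E → ℝ} {g : E → E} {c β : ℝ}

section StepLength

variable [CompleteSpace E] {θ Δ : E}

theorem exists_sufficientIncrease_pow (hf : HasGradientAt f (g θ) θ)
    (hΔ : 0 < inner ℝ (g θ) Δ) (hc : c < 1) (hβ₀ : 0 < β) (hβ₁ : β < 1) :
    ∃ j : ℕ, SufficientIncrease f g c θ Δ (β ^ j) := by
  have hderiv : HasDerivAt (fun r : ℝ ↦ f (θ + r • Δ)) (inner ℝ (g θ) Δ) 0 := by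
    exact (hasDerivAt_comp_add_smul (by simpa using hf.hasFDerivAt)).congr_deriv
      (InnerProductSpace.toDual_apply_apply)
  have hslope : ∀ᶠ r in 𝓝[>] (0 : ℝ),
      c * inner ℝ (g θ) Δ < r⁻¹ * (f (θ + r • Δ) - f θ) := by
    simpa using hderiv.tendsto_slope_zero_right.eventually_const_lt (mul_lt_of_lt_one_left hΔ hc)
  have hpow : Tendsto (fun j : ℕ ↦ β ^ j) atTop (𝓝[>] 0) :=
    tendsto_nhdsWithin_iff.2 ⟨tendsto_pow_atTop_nhds_zero_of_lt_one hβ₀.le hβ₁,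
      Eventually.of_forall fun j ↦ pow_pos hβ₀ j⟩
  obtain ⟨j, hj⟩ := (hpow.eventually hslope).exists
  rw [lt_inv_mul_iff₀ (pow_pos hβ₀ j)] at hj
  exact ⟨j, by rw [SufficientIncrease]; linarith⟩

theorem sufficientIncrease_of_mul_le (hf : ∀ y, HasGradientAt f (g y) y) {Λ : ℝ≥0}
    (hg : LipschitzWith Λ g) {α : ℝ} (hα : 0 ≤ α)
    (hle : α * Λ * ‖Δ‖ ^ 2 ≤ 2 * (1 - c) * inner ℝ (g θ) Δ) : SufficientIncrease f g c θ Δ α := by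
  have htaylor := (abs_le.1 (abs_sub_sub_inner_le_of_lipschitzWith hf hg θ (α • Δ))).1
  rw [inner_smul_right, norm_smul, Real.norm_of_nonneg hα] at htaylor
  have := mul_le_mul_of_nonneg_left hle hα
  rw [SufficientIncrease]
  linarith

theorem min_one_mul_le_pow_of_isLeast_sufficientIncrease (hf : ∀ y, HasGradientAt f (g y) y)
    {Λ : ℝ≥0} (hg : LipschitzWith Λ g) (hc : c ≤ 1) (hβ : 0 ≤ β) {m a : ℝ}
    (ha : a * Λ ≤ 2 * (1 - c) * m) (hΔ : m * ‖Δ‖ ^ 2 ≤ inner ℝ (g θ) Δ) {n : ℕ}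
    (hn : IsLeast {j : ℕ | SufficientIncrease f g c θ Δ (β ^ j)} n) : min 1 (β * a) ≤ β ^ n := by
  rcases n with _ | n
  · simp
  have hrejected : ¬SufficientIncrease f g c θ Δ (β ^ n) := fun h ↦ by
    have := hn.2 h
    omega
  rw [pow_succ']
  refine (min_le_right _ _).trans (mul_le_mul_of_nonneg_left ?_ hβ)
  contrapose! hrejected
  refine sufficientIncrease_of_mul_le hf hg (pow_nonneg hβ n) ?_
  calc β ^ n * Λ * ‖Δ‖ ^ 2 ≤ a * Λ * ‖Δ‖ ^ 2 := by gcongr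
    _ ≤ 2 * (1 - c) * m * ‖Δ‖ ^ 2 := by gcongr
    _ = 2 * (1 - c) * (m * ‖Δ‖ ^ 2) := by ring
    _ ≤ 2 * (1 - c) * inner ℝ (g θ) Δ :=
      mul_le_mul_of_nonneg_left hΔ (mul_nonneg zero_le_two (sub_nonneg.2 hc))

theorem sufficientIncrease_one_of_newton_step {g' : E → E →L[ℝ] E} {s : Set E}
    (hs : Convex ℝ s) (hf : ∀ y ∈ s, HasGradientAt f (g y) y)
    (hg : ∀ y ∈ s, HasFDerivAt g (g' y) y) {M : ℝ≥0} (hM : LipschitzOnWith M g' s)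
    (hθ : θ ∈ s) (hθΔ : θ + Δ ∈ s) (hnewton : g' θ Δ = -g θ) {m : ℝ}
    (hΔ : m * ‖Δ‖ ^ 2 ≤ inner ℝ (g θ) Δ) (hc : c ≤ 1 / 2)
    (hshort : M / 6 * ‖Δ‖ ≤ (1 / 2 - c) * m) : SufficientIncrease f g c θ Δ 1 := by
  have htaylor := (abs_le.1
    (abs_sub_sub_inner_sub_half_inner_le_of_lipschitzOnWith hs hf hg hM hθ hθΔ)).1
  rw [hnewton, inner_neg_left] at htaylor
  have hcubic : M / 6 * ‖Δ‖ ^ 3 ≤ (1 / 2 - c) * inner ℝ (g θ) Δ := by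
    calc M / 6 * ‖Δ‖ ^ 3 = M / 6 * ‖Δ‖ * ‖Δ‖ ^ 2 := by ring
      _ ≤ (1 / 2 - c) * m * ‖Δ‖ ^ 2 := by gcongr
      _ = (1 / 2 - c) * (m * ‖Δ‖ ^ 2) := by ring
      _ ≤ (1 / 2 - c) * inner ℝ (g θ) Δ := mul_le_mul_of_nonneg_left hΔ (sub_nonneg.2 hc)
  rw [SufficientIncrease, one_smul]
  linarith

end StepLength

namespace IsBacktrackingAscent

variable {θ Δ : ℕ → E} {n : ℕ → ℕ}

theorem le_image_succ (h : IsBacktrackingAscent f g c β θ Δ n) (k : ℕ) :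
    f (θ k) + c * β ^ n k * inner ℝ (g (θ k)) (Δ k) ≤ f (θ (k + 1)) := by
  rw [h.step k]
  exact (h.search k).1

theorem monotone (h : IsBacktrackingAscent f g c β θ Δ n) (hc : 0 ≤ c) (hβ : 0 ≤ β)
    (hΔ : ∀ k, 0 ≤ inner ℝ (g (θ k)) (Δ k)) : Monotone fun k ↦ f (θ k) :=
  monotone_nat_of_le_succ fun k ↦ (le_add_of_nonneg_right
    (mul_nonneg (mul_nonneg hc (pow_nonneg hβ _)) (hΔ k))).trans (h.le_image_succ k)

/-- Step lengths are bounded below, so each step gains a fixed multiple of `‖Δ k‖ ^ 2`; the gains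
of a bounded monotone sequence tend to zero. -/
theorem tendsto_direction [CompleteSpace E] (h : IsBacktrackingAscent f g c β θ Δ n)
    (hf : ∀ y, HasGradientAt f (g y) y) {Λ : ℝ≥0} (hg : LipschitzWith Λ g) (hc₀ : 0 < c)
    (hc₁ : c < 1) (hβ : 0 < β) {m : ℝ} (hm : 0 < m)
    (hΔ : ∀ k, m * ‖Δ k‖ ^ 2 ≤ inner ℝ (g (θ k)) (Δ k))
    (hbdd : BddAbove (range fun k ↦ f (θ k))) : Tendsto Δ atTop (𝓝 0) := by
  have hmono := h.monotone hc₀.le hβ.le fun k ↦ (by positivity : 0 ≤ m * ‖Δ k‖ ^ 2).trans (hΔ k)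
  have hconv := tendsto_atTop_ciSup hmono hbdd
  have hgain : Tendsto (fun k ↦ f (θ (k + 1)) - f (θ k)) atTop (𝓝 0) := by
    simpa using ((tendsto_add_atTop_iff_nat 1).2 hconv).sub hconv
  set a := 2 * (1 - c) * m / (Λ + 1) with ha
  have ha₀ : 0 < a := by
    have := sub_pos.2 hc₁
    positivity
  have haΛ : a * Λ ≤ 2 * (1 - c) * m := by
    rw [ha, div_mul_eq_mul_div, div_le_iff₀ (by positivity)]
    have : 0 < 2 * (1 - c) * m := by have := sub_pos.2 hc₁; positivity
    gcongr
    linarith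
  have hsq : ∀ k, ‖Δ k‖ ^ 2 ≤ (c * min 1 (β * a) * m)⁻¹ * (f (θ (k + 1)) - f (θ k)) := fun k ↦ by
    rw [le_inv_mul_iff₀ (by positivity), le_sub_iff_add_le']
    refine le_trans ?_ (h.le_image_succ k)
    rw [mul_assoc]
    gcongr
    · exact min_one_mul_le_pow_of_isLeast_sufficientIncrease hf hg hc₁.le hβ.le haΛ (hΔ k)
        (h.search k)
    · exact hΔ k
  have hsq_lim : Tendsto (fun k ↦ ‖Δ k‖ ^ 2) atTop (𝓝 0) :=
    squeeze_zero (fun k ↦ by positivity) hsq (by simpa using hgain.const_mul _)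
  exact tendsto_zero_iff_norm_tendsto_zero.2 (by simpa using hsq_lim.sqrt)

end IsBacktrackingAscent

theorem mul_norm_le_norm_of_mul_sq_le_inner {m : ℝ} {v y : E}
    (h : m * ‖v‖ ^ 2 ≤ inner ℝ y v) : m * ‖v‖ ≤ ‖y‖ := by
  rcases (norm_nonneg v).eq_or_lt with hv | hv
  · simp [← hv]
  · refine le_of_mul_le_mul_right ?_ hv
    calc m * ‖v‖ * ‖v‖ = m * ‖v‖ ^ 2 := by ring
      _ ≤ ‖y‖ * ‖v‖ := h.trans (real_inner_le_norm _ _)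

theorem exists_radius_newton_step [CompleteSpace E] {g' : E → E →L[ℝ] E} {U : Set E} {θs : E}
    (hU : U ∈ 𝓝 θs) (hf : ∀ y ∈ U, HasGradientAt f (g y) y)
    (hg : ∀ y ∈ U, HasFDerivAt g (g' y) y) {M : ℝ≥0} (hM : LipschitzOnWith M g' U) {m : ℝ}
    (hm : 0 < m) (hconcave : ∀ y ∈ U, ∀ v, m * ‖v‖ ^ 2 ≤ -inner ℝ (g' y v) v)
    (hzero : g θs = 0) (hc : c < 1 / 2) :
    ∃ r > 0, ∀ θ Δ, ‖θ - θs‖ < r → g' θ Δ = -g θ →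
      SufficientIncrease f g c θ Δ 1 ∧ ‖θ + Δ - θs‖ ≤ M / (2 * m) * ‖θ - θs‖ ^ 2 ∧
        ‖θ + Δ - θs‖ ≤ 1 / 2 * ‖θ - θs‖ := by
  obtain ⟨ρ, hρ, hball⟩ := Metric.mem_nhds_iff.1 hU
  have : 0 < 1 / 2 - c := sub_pos.2 hc
  refine ⟨min ρ (min (m / (M + 1)) ((1 / 2 - c) * m / (M + 1))), by positivity,
    fun θ Δ hθ hΔ ↦ ?_⟩
  simp only [lt_min_iff, lt_div_iff₀ (by positivity : (0 : ℝ) < M + 1)] at hθ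
  obtain ⟨hθρ, hθm, hθc⟩ := hθ
  have hs := convex_ball θs ρ
  have hf' := fun y hy ↦ hf y (hball hy)
  have hg' := fun y hy ↦ hg y (hball hy)
  have hθball : θ ∈ Metric.ball θs ρ := mem_ball_iff_norm.2 hθρ
  have hbelow : ∀ v, m * ‖v‖ ≤ ‖g' θ v‖ := fun v ↦ by
    simpa using mul_norm_le_norm_of_mul_sq_le_inner (y := -g' θ v)
      (by simpa using hconcave θ (hball hθball) v)
  have hquad : ‖θ + Δ - θs‖ ≤ M / (2 * m) * ‖θ - θs‖ ^ 2 :=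
    norm_newton_step_sub_zero_le hs hg' (hM.mono hball) hθball (Metric.mem_ball_self hρ) hzero hm
      hbelow hΔ
  have hn₀ := norm_nonneg (θ - θs)
  have hhalf : ‖θ + Δ - θs‖ ≤ 1 / 2 * ‖θ - θs‖ := by
    refine hquad.trans ?_
    rw [sq, ← mul_assoc]
    refine mul_le_mul_of_nonneg_right ?_ hn₀
    rw [div_mul_eq_mul_div, div_le_iff₀ (by positivity)]
    linarith
  have hΔ_le : ‖Δ‖ ≤ 2 * ‖θ - θs‖ := by
    have := norm_sub_le (θ + Δ - θs) (θ - θs)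
    rw [show θ + Δ - θs - (θ - θs) = Δ by abel] at this
    linarith
  refine ⟨sufficientIncrease_one_of_newton_step hs hf' hg' (hM.mono hball) hθball
    (mem_ball_iff_norm.2 (by linarith)) hΔ ?_ hc.le (m := m) ?_, hquad, hhalf⟩
  · simpa [hΔ] using hconcave θ (hball hθball) Δ
  · calc M / 6 * ‖Δ‖ ≤ M / 6 * (2 * ‖θ - θs‖) := by gcongr
      _ ≤ (1 / 2 - c) * m := by linarith [mul_nonneg M.coe_nonneg hn₀]

end Backtracking

theorem tendsto_of_dist_succ_le {X : Type*} [PseudoMetricSpace X] {u : ℕ → X} {a : X} {r q : ℝ}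
    (hq₀ : 0 ≤ q) (hq₁ : q < 1) (hu₀ : dist (u 0) a < r)
    (hu : ∀ k, dist (u k) a < r → dist (u (k + 1)) a ≤ q * dist (u k) a) :
    (∀ k, dist (u k) a < r) ∧ Tendsto u atTop (𝓝 a) := by
  have hstep : ∀ k, dist (u k) a ≤ q ^ k * dist (u 0) a := by
    intro k
    induction k with
    | zero => simp
    | succ k ih =>
      have hk : dist (u k) a < r := ih.trans_lt
        ((mul_le_of_le_one_left dist_nonneg (pow_le_one₀ hq₀ hq₁.le)).trans_lt hu₀)
      calc dist (u (k + 1)) a ≤ q * dist (u k) a := hu k hk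
        _ ≤ q * (q ^ k * dist (u 0) a) := by gcongr
        _ = q ^ (k + 1) * dist (u 0) a := by ring
  refine ⟨fun k ↦ (hstep k).trans_lt
    ((mul_le_of_le_one_left dist_nonneg (pow_le_one₀ hq₀ hq₁.le)).trans_lt hu₀), ?_⟩
  refine tendsto_iff_dist_tendsto_zero.2 (squeeze_zero (fun _ ↦ dist_nonneg) hstep ?_)
  simpa using (tendsto_pow_atTop_nhds_zero_of_lt_one hq₀ hq₁).mul_const (dist (u 0) a)

/-! ### Convex geometry -/

section ConvexGeometry

variable {E : Type*} [NormedAddCommGroup E]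

theorem exists_pos_forall_add_mem_of_mem_intrinsicInterior [NormedSpace ℝ E] {s : Set E} {t : E}
    (ht : t ∈ intrinsicInterior ℝ s) :
    ∃ ε > 0, ∀ v ∈ vectorSpan ℝ s, ‖v‖ ≤ ε → t + v ∈ s := by
  obtain ⟨p, hp, rfl⟩ := mem_intrinsicInterior.1 ht
  obtain ⟨ε, hε, hball⟩ := Metric.mem_nhds_iff.1 (mem_interior_iff_mem_nhds.1 hp)
  refine ⟨ε / 2, half_pos hε, fun v hv hvε ↦ ?_⟩
  have hmem : (p : E) + v ∈ affineSpan ℝ s := by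
    rw [add_comm]
    exact AffineSubspace.vadd_mem_of_mem_direction ((direction_affineSpan ℝ s).symm ▸ hv) p.2
  refine @hball ⟨p + v, hmem⟩ ?_
  rw [Metric.mem_ball, Subtype.dist_eq, dist_self_add_left]
  linarith

variable [InnerProductSpace ℝ E]

theorem exists_pos_forall_exists_add_mul_norm_le_inner {ι : Type*} {x : ι → E} {t : E}
    (ht : t ∈ intrinsicInterior ℝ (convexHull ℝ (range x))) :
    ∃ ε > 0, ∀ v ∈ vectorSpan ℝ (range x), ∃ i, inner ℝ v t + ε * ‖v‖ ≤ inner ℝ v (x i) := by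
  obtain ⟨ε, hε, hmem⟩ := exists_pos_forall_add_mem_of_mem_intrinsicInterior ht
  rw [← direction_affineSpan, affineSpan_convexHull, direction_affineSpan] at hmem
  refine ⟨ε, hε, fun v hv ↦ ?_⟩
  have hnorm : ‖(ε / ‖v‖) • v‖ ≤ ε := by
    rw [norm_smul, norm_div, norm_norm, Real.norm_of_nonneg hε.le,
      mul_comm_div]
    exact mul_le_of_le_one_right hε.le (div_self_le_one _)
  obtain ⟨-, ⟨i, rfl⟩, hi⟩ :=
    ((innerₛₗ ℝ v).convexOn (convex_convexHull ℝ (range x))).exists_ge_of_mem_convexHull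
      (subset_convexHull ℝ _) (hmem _ (Submodule.smul_mem _ _ hv) hnorm)
  refine ⟨i, (le_of_eq ?_).trans hi⟩
  rcases eq_or_ne v 0 with rfl | hv₀
  · simp
  · have := norm_ne_zero_iff.2 hv₀
    rw [innerₛₗ_apply_apply, inner_add_right, inner_smul_right, real_inner_self_eq_norm_sq]
    field_simp

theorem inner_eq_inner_of_mem_orthogonal_vectorSpan {s : Set E} {v y z : E}
    (hv : v ∈ (vectorSpan ℝ s)ᗮ) (hy : y ∈ affineSpan ℝ s) (hz : z ∈ affineSpan ℝ s) :
    inner ℝ v y = inner ℝ v z := by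
  rw [← sub_eq_zero, ← inner_sub_right]
  exact (Submodule.mem_orthogonal' _ v).1 hv _
    (vsub_mem_vectorSpan_of_mem_affineSpan_of_mem_affineSpan hy hz)

theorem mem_orthogonal_vectorSpan_of_forall_inner_eq {s : Set E} {v p : E}
    (hv : ∀ y ∈ s, inner ℝ v y = inner ℝ v p) : v ∈ (vectorSpan ℝ s)ᗮ := by
  have hle : vectorSpan ℝ s ≤ (ℝ ∙ v)ᗮ := by
    rw [vectorSpan_def, Submodule.span_le]
    rintro _ ⟨y, hy, z, hz, rfl⟩
    simp [Submodule.mem_orthogonal_singleton_iff_inner_right, inner_sub_right, hv y hy, hv z hz]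
  exact fun u hu ↦ Submodule.mem_orthogonal_singleton_iff_inner_left.1 (hle hu)

theorem apply_starProjection_eq_of_forall_mem_orthogonal {Y : Type*} {V : Submodule ℝ E}
    [V.HasOrthogonalProjection] {F : E → Y} (hF : ∀ y, ∀ d ∈ Vᗮ, F (y + d) = F y) (y : E) :
    F (V.starProjection y) = F y := by
  simpa using (hF (V.starProjection y) _ (V.sub_starProjection_mem_orthogonal y)).symm

theorem tendsto_comp_of_tendsto_starProjection {ι Y : Type*} [TopologicalSpace Y]
    {V : Submodule ℝ E} [V.HasOrthogonalProjection] {F : E → Y} (hF : Continuous F)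
    (hFV : ∀ y, F (V.starProjection y) = F y) {l : Filter ι} {u : ι → E} {a : E}
    (hu : Tendsto (fun k ↦ V.starProjection (u k)) l (𝓝 (V.starProjection a))) :
    Tendsto (fun k ↦ F (u k)) l (𝓝 (F a)) := by
  simpa only [Function.comp_def, hFV] using (hF.tendsto _).comp hu

theorem exists_pos_forall_mul_sq_le_inner {X : Type*} [TopologicalSpace X] {C : Set X}
    (hC : IsCompact C) {A : X → E →L[ℝ] E} (hA : ContinuousOn A C) (V : Submodule ℝ E)
    [FiniteDimensional ℝ V] (hpos : ∀ y ∈ C, ∀ v ∈ V, v ≠ 0 → 0 < inner ℝ (A y v) v) :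
    ∃ m > 0, ∀ y ∈ C, ∀ v ∈ V, m * ‖v‖ ^ 2 ≤ inner ℝ (A y v) v := by
  have hcont : ContinuousOn (fun p : X × V ↦ inner ℝ (A p.1 p.2) (p.2 : E))
      (C ×ˢ Metric.sphere 0 1) := by
    have hv : ContinuousOn (fun p : X × V ↦ (p.2 : E)) (C ×ˢ Metric.sphere 0 1) := by fun_prop
    exact ((hA.comp continuousOn_fst fun p hp ↦ hp.1).clm_apply hv).inner hv
  obtain ⟨m, hm, hle⟩ := (hC.prod (isCompact_sphere (0 : V) 1)).exists_forall_le' hcont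
    (a := 0) fun p hp ↦ hpos p.1 hp.1 p.2 p.2.2 fun h ↦ by simp_all
  refine ⟨m, hm, fun y hy v hv ↦ ?_⟩
  rcases eq_or_ne v 0 with rfl | hv₀
  · simp
  have hunit := hle ⟨y, ‖v‖⁻¹ • ⟨v, hv⟩⟩ ⟨hy, by simp [norm_smul, hv₀]⟩
  simp only [Submodule.coe_smul, map_smul, inner_smul_left, inner_smul_right,
    conj_trivial] at hunit
  have := norm_ne_zero_iff.2 hv₀
  calc m * ‖v‖ ^ 2 ≤ ‖v‖⁻¹ * (‖v‖⁻¹ * inner ℝ (A y v) v) * ‖v‖ ^ 2 := by gcongr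
    _ = inner ℝ (A y v) v := by field_simp

end ConvexGeometry

/-! ### Weighted means and covariances -/

section Covariance

variable {N K : ℕ} {w : Fin N → ℝ} {x : Fin N → EuclideanSpace ℝ (Fin K)}
  {y v : EuclideanSpace ℝ (Fin K)}

theorem wMean_mem_affineSpan (hw : ∑ i, w i = 1) : wMean w x ∈ affineSpan ℝ (range x) := by
  rw [wMean, ← Finset.affineCombination_eq_linear_combination _ _ _ hw]
  exact affineCombination_mem_affineSpan hw x

theorem wMean_mem_convexHull (hw₀ : ∀ i, 0 ≤ w i) (hw : ∑ i, w i = 1) :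
    wMean w x ∈ convexHull ℝ (range x) :=
  (convex_convexHull ℝ _).sum_mem (fun i _ ↦ hw₀ i) hw
    fun i _ ↦ subset_convexHull ℝ _ (mem_range_self i)

theorem sub_wMean_mem_vectorSpan (hw : ∑ i, w i = 1) (hy : y ∈ affineSpan ℝ (range x)) :
    y - wMean w x ∈ vectorSpan ℝ (range x) :=
  vsub_mem_vectorSpan_of_mem_affineSpan_of_mem_affineSpan hy (wMean_mem_affineSpan hw)

theorem norm_sub_wMean_le_diam (hw₀ : ∀ i, 0 ≤ w i) (hw : ∑ i, w i = 1) (i : Fin N) :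
    ‖x i - wMean w x‖ ≤ Metric.diam (range x) := by
  rw [← dist_eq_norm, ← convexHull_diam]
  exact Metric.dist_le_diam_of_mem (isBounded_convexHull.2 (finite_range x).isBounded)
    (subset_convexHull ℝ _ (mem_range_self i)) (wMean_mem_convexHull hw₀ hw)

@[fun_prop]
theorem continuous_wMean (x : Fin N → EuclideanSpace ℝ (Fin K)) :
    Continuous fun w ↦ wMean w x := by
  unfold wMean
  fun_prop

/-- The covariance matrix `wCov w x` acting on Euclidean space, bundled as a continuous linear
map so that it can be compared with Fréchet derivatives. -/
noncomputable def covOperator (w : Fin N → ℝ) (x : Fin N → EuclideanSpace ℝ (Fin K)) :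
    EuclideanSpace ℝ (Fin K) →L[ℝ] EuclideanSpace ℝ (Fin K) :=
  (Matrix.toEuclideanLin (wCov w x)).toContinuousLinearMap

theorem toEuclideanLin_wCov_add_smul_one (δ : ℝ) (v : EuclideanSpace ℝ (Fin K)) :
    Matrix.toEuclideanLin (wCov w x + δ • (1 : Matrix (Fin K) (Fin K) ℝ)) v =
      covOperator w x v + δ • v := by
  rw [map_add, map_smul, Matrix.toLpLin_one]
  rfl

theorem covOperator_apply (v : EuclideanSpace ℝ (Fin K)) :
    covOperator w x v =
      ∑ i, (w i * inner ℝ (x i - wMean w x) v) • (x i - wMean w x) := by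
  change Matrix.toEuclideanLin (wCov w x) v = _
  simp only [wCov, map_sum, map_smul, LinearMap.sum_apply, LinearMap.smul_apply, mul_smul]
  refine Finset.sum_congr rfl fun i _ ↦ ?_
  congr 1
  ext j
  simp only [Matrix.toLpLin_apply, Matrix.mulVec, Matrix.vecMulVec, dotProduct, Matrix.of_apply,
    PiLp.smul_apply, smul_eq_mul, PiLp.inner_apply, RCLike.inner_apply, conj_trivial,
    Finset.sum_mul]
  exact Finset.sum_congr rfl fun k _ ↦ by ring

theorem continuous_covOperator (x : Fin N → EuclideanSpace ℝ (Fin K)) :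
    Continuous fun w ↦ covOperator w x := by
  refine continuous_clm_apply.2 fun v ↦ ?_
  simp only [covOperator_apply]
  fun_prop

theorem inner_covOperator_apply (v u : EuclideanSpace ℝ (Fin K)) :
    inner ℝ (covOperator w x v) u =
      ∑ i, w i * inner ℝ (x i - wMean w x) v * inner ℝ (x i - wMean w x) u := by
  simp only [covOperator_apply, sum_inner, inner_smul_left, conj_trivial]

theorem isSymmetric_covOperator : (covOperator w x).IsSymmetric := fun v u ↦ by
  refine Eq.trans ?_ (real_inner_comm _ _)
  simp only [ContinuousLinearMap.coe_coe, inner_covOperator_apply, mul_right_comm]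

theorem inner_covOperator_self_nonneg (hw₀ : ∀ i, 0 ≤ w i) (v : EuclideanSpace ℝ (Fin K)) :
    0 ≤ inner ℝ (covOperator w x v) v := by
  simp only [inner_covOperator_apply, mul_assoc]
  exact Finset.sum_nonneg fun i _ ↦ mul_nonneg (hw₀ i) (mul_self_nonneg _)

theorem covOperator_apply_mem_vectorSpan (hw : ∑ i, w i = 1) (v : EuclideanSpace ℝ (Fin K)) :
    covOperator w x v ∈ vectorSpan ℝ (range x) := by
  rw [covOperator_apply]
  exact Submodule.sum_mem _ fun i _ ↦ Submodule.smul_mem _ _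
    (sub_wMean_mem_vectorSpan hw (mem_affineSpan ℝ (mem_range_self i)))

theorem covOperator_apply_eq_zero_of_mem_orthogonal (hw : ∑ i, w i = 1)
    (hv : v ∈ (vectorSpan ℝ (range x))ᗮ) : covOperator w x v = 0 := by
  refine (covOperator_apply v).trans (Finset.sum_eq_zero fun i _ ↦ ?_)
  rw [hv _ (sub_wMean_mem_vectorSpan hw (mem_affineSpan ℝ (mem_range_self i))), mul_zero,
    zero_smul]

theorem mem_orthogonal_of_inner_covOperator_self_nonpos (hw₀ : ∀ i, 0 < w i)
    (hv : inner ℝ (covOperator w x v) v ≤ 0) : v ∈ (vectorSpan ℝ (range x))ᗮ := by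
  have hvariance := hv.antisymm (inner_covOperator_self_nonneg (fun i ↦ (hw₀ i).le) v)
  simp only [inner_covOperator_apply, mul_assoc] at hvariance
  rw [Finset.sum_eq_zero_iff_of_nonneg
    fun i _ ↦ mul_nonneg (hw₀ i).le (mul_self_nonneg _)] at hvariance
  refine mem_orthogonal_vectorSpan_of_forall_inner_eq (p := wMean w x) ?_
  rintro _ ⟨i, rfl⟩
  have := hvariance i (Finset.mem_univ i)
  rw [mul_eq_zero, or_iff_right (hw₀ i).ne', mul_self_eq_zero, real_inner_comm] at this
  rwa [inner_sub_right, sub_eq_zero] at this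

theorem inner_covOperator_self_pos (hw₀ : ∀ i, 0 < w i) (hv : v ∈ vectorSpan ℝ (range x))
    (hv₀ : v ≠ 0) : 0 < inner ℝ (covOperator w x v) v := by
  contrapose! hv₀
  exact inner_self_eq_zero.1 (mem_orthogonal_of_inner_covOperator_self_nonpos hw₀ hv₀ v hv)

theorem norm_covOperator_le (hw₀ : ∀ i, 0 ≤ w i) (hw : ∑ i, w i = 1) :
    ‖covOperator w x‖ ≤ Metric.diam (range x) ^ 2 := by
  refine ContinuousLinearMap.opNorm_le_bound _ (by positivity) fun v ↦ ?_
  have hterm : ∀ i, ‖(w i * inner ℝ (x i - wMean w x) v) • (x i - wMean w x)‖ ≤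
      w i * (Metric.diam (range x) ^ 2 * ‖v‖) := fun i ↦ by
    have hdiam := norm_sub_wMean_le_diam (x := x) hw₀ hw i
    rw [norm_smul, norm_mul, Real.norm_of_nonneg (hw₀ i), mul_assoc]
    refine mul_le_mul_of_nonneg_left ?_ (hw₀ i)
    calc ‖inner ℝ (x i - wMean w x) v‖ * ‖x i - wMean w x‖
        ≤ ‖x i - wMean w x‖ * ‖v‖ * ‖x i - wMean w x‖ := by gcongr; exact norm_inner_le_norm _ _
      _ ≤ Metric.diam (range x) * ‖v‖ * Metric.diam (range x) := by gcongr
      _ = Metric.diam (range x) ^ 2 * ‖v‖ := by ring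
  rw [covOperator_apply]
  refine (norm_sum_le_of_le _ fun i _ ↦ hterm i).trans_eq ?_
  rw [← Finset.sum_mul, hw, one_mul]

theorem mul_norm_sq_le_inner_covOperator_of_posSemidef {m : ℝ}
    (h : (wCov w x - m • (1 : Matrix (Fin K) (Fin K) ℝ)).PosSemidef)
    (v : EuclideanSpace ℝ (Fin K)) : m * ‖v‖ ^ 2 ≤ inner ℝ (covOperator w x v) v := by
  have hnonneg := (Matrix.isPositive_toEuclideanLin_iff.2 h).inner_nonneg_left v
  rw [sub_eq_add_neg, ← neg_smul, toEuclideanLin_wCov_add_smul_one, inner_add_left,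
    inner_smul_left, real_inner_self_eq_norm_sq, conj_trivial] at hnonneg
  linarith

theorem inner_wMean_le_log_sum_exp (hw₀ : ∀ i, 0 ≤ w i) (hw : ∑ i, w i = 1)
    (d : EuclideanSpace ℝ (Fin K)) :
    inner ℝ d (wMean w x) ≤ Real.log (∑ i, w i * Real.exp (inner ℝ d (x i))) := by
  have hjensen := convexOn_exp.map_sum_le (t := Finset.univ) (p := fun i ↦ inner ℝ d (x i))
    (fun i _ ↦ hw₀ i) hw fun i _ ↦ mem_univ _
  simp only [smul_eq_mul, ← inner_smul_right, ← inner_sum] at hjensen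
  exact (Real.le_log_iff_exp_le ((Real.exp_pos _).trans_le hjensen)).2 hjensen

theorem inner_wMean_lt_log_sum_exp (hw₀ : ∀ i, 0 < w i) (hw : ∑ i, w i = 1)
    {d : EuclideanSpace ℝ (Fin K)} (hd : d ∉ (vectorSpan ℝ (range x))ᗮ) :
    inner ℝ d (wMean w x) < Real.log (∑ i, w i * Real.exp (inner ℝ d (x i))) := by
  obtain ⟨i, j, hij⟩ : ∃ i j, inner ℝ d (x i) ≠ inner ℝ d (x j) := by
    contrapose! hd
    rcases isEmpty_or_nonempty (Fin N) with _ | ⟨⟨j⟩⟩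
    · simp at hw
    · exact mem_orthogonal_vectorSpan_of_forall_inner_eq (forall_mem_range.2 fun i ↦ hd i j)
  have hjensen := strictConvexOn_exp.map_sum_lt (t := Finset.univ)
    (p := fun i ↦ inner ℝ d (x i)) (fun i _ ↦ hw₀ i) hw (fun i _ ↦ mem_univ _)
    ⟨i, Finset.mem_univ i, j, Finset.mem_univ j, hij⟩
  simp only [smul_eq_mul, ← inner_smul_right, ← inner_sum] at hjensen
  exact (Real.lt_log_iff_exp_lt ((Real.exp_pos _).trans hjensen)).2 hjensen

end Covariance

/-! ### Exponential tilting -/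

section Tilting

variable {N K : ℕ} {b : Fin N → ℝ} {x : Fin N → EuclideanSpace ℝ (Fin K)}
  {t d θs : EuclideanSpace ℝ (Fin K)}

theorem partitionFn_pos [Nonempty (Fin N)] (hb : ∀ i, 0 < b i) (θ : EuclideanSpace ℝ (Fin K)) :
    0 < partitionFn b x θ :=
  Finset.sum_pos (fun i _ ↦ mul_pos (hb i) (Real.exp_pos _)) Finset.univ_nonempty

theorem tilt_pos [Nonempty (Fin N)] (hb : ∀ i, 0 < b i) (θ : EuclideanSpace ℝ (Fin K))
    (i : Fin N) : 0 < tilt b x θ i :=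
  div_pos (mul_pos (hb i) (Real.exp_pos _)) (partitionFn_pos hb θ)

theorem sum_tilt [Nonempty (Fin N)] (hb : ∀ i, 0 < b i) (θ : EuclideanSpace ℝ (Fin K)) :
    ∑ i, tilt b x θ i = 1 := by
  simp only [tilt, ← Finset.sum_div]
  exact div_self (partitionFn_pos hb θ).ne'

theorem partitionFn_add [Nonempty (Fin N)] (hb : ∀ i, 0 < b i)
    (θ d : EuclideanSpace ℝ (Fin K)) :
    partitionFn b x (θ + d) =
      partitionFn b x θ * ∑ i, tilt b x θ i * Real.exp (inner ℝ d (x i)) := by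
  have hZ := (partitionFn_pos (x := x) hb θ).ne'
  rw [Finset.mul_sum, partitionFn]
  refine Finset.sum_congr rfl fun i _ ↦ ?_
  rw [tilt, inner_add_left, Real.exp_add]
  field_simp

theorem dualObj_add [Nonempty (Fin N)] (hb : ∀ i, 0 < b i) (θ d : EuclideanSpace ℝ (Fin K)) :
    dualObj b x t (θ + d) = dualObj b x t θ +
      (inner ℝ d t - Real.log (∑ i, tilt b x θ i * Real.exp (inner ℝ d (x i)))) := by
  have hsum : 0 < ∑ i, tilt b x θ i * Real.exp (inner ℝ d (x i)) :=
    Finset.sum_pos (fun i _ ↦ mul_pos (tilt_pos hb θ i) (Real.exp_pos _)) Finset.univ_nonempty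
  rw [dualObj, dualObj, partitionFn_add hb, Real.log_mul (partitionFn_pos hb θ).ne' hsum.ne',
    inner_add_left]
  ring

theorem dualObj_add_le [Nonempty (Fin N)] (hb : ∀ i, 0 < b i)
    (θ d : EuclideanSpace ℝ (Fin K)) :
    dualObj b x t (θ + d) ≤ dualObj b x t θ + inner ℝ (dualResidual b x t θ) d := by
  rw [dualObj_add hb, real_inner_comm d, dualResidual, inner_sub_right]
  gcongr
  exact inner_wMean_le_log_sum_exp (fun i ↦ (tilt_pos hb θ i).le) (sum_tilt hb θ) d

theorem dualObj_add_lt [Nonempty (Fin N)] (hb : ∀ i, 0 < b i) (θ : EuclideanSpace ℝ (Fin K))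
    (hd : d ∉ (vectorSpan ℝ (range x))ᗮ) :
    dualObj b x t (θ + d) < dualObj b x t θ + inner ℝ (dualResidual b x t θ) d := by
  rw [dualObj_add hb, real_inner_comm d, dualResidual, inner_sub_right]
  gcongr
  exact inner_wMean_lt_log_sum_exp (tilt_pos hb θ) (sum_tilt hb θ) hd

section Invariance

theorem partitionFn_add_of_mem_orthogonal (θ : EuclideanSpace ℝ (Fin K))
    (hd : d ∈ (vectorSpan ℝ (range x))ᗮ) {p : EuclideanSpace ℝ (Fin K)}
    (hp : p ∈ affineSpan ℝ (range x)) :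
    partitionFn b x (θ + d) = partitionFn b x θ * Real.exp (inner ℝ d p) := by
  rw [partitionFn, partitionFn, Finset.sum_mul]
  refine Finset.sum_congr rfl fun i _ ↦ ?_
  rw [inner_add_left, Real.exp_add, mul_assoc, inner_eq_inner_of_mem_orthogonal_vectorSpan hd
    (mem_affineSpan ℝ (mem_range_self i)) hp]

theorem tilt_add_of_mem_orthogonal (θ : EuclideanSpace ℝ (Fin K))
    (hd : d ∈ (vectorSpan ℝ (range x))ᗮ) : tilt b x (θ + d) = tilt b x θ := by
  ext i
  rw [tilt, tilt,
    partitionFn_add_of_mem_orthogonal θ hd (mem_affineSpan ℝ (mem_range_self i)),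
    inner_add_left, Real.exp_add, ← mul_assoc, mul_div_mul_right _ _ (Real.exp_pos _).ne']

theorem dualObj_add_of_mem_orthogonal [Nonempty (Fin N)] (hb : ∀ i, 0 < b i)
    (ht : t ∈ affineSpan ℝ (range x)) (θ : EuclideanSpace ℝ (Fin K))
    (hd : d ∈ (vectorSpan ℝ (range x))ᗮ) : dualObj b x t (θ + d) = dualObj b x t θ := by
  rw [dualObj, dualObj, partitionFn_add_of_mem_orthogonal θ hd ht,
    Real.log_mul (partitionFn_pos hb θ).ne' (Real.exp_pos _).ne', Real.log_exp, inner_add_left]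
  ring

theorem dualResidual_mem_vectorSpan [Nonempty (Fin N)] (hb : ∀ i, 0 < b i)
    (ht : t ∈ affineSpan ℝ (range x)) (θ : EuclideanSpace ℝ (Fin K)) :
    dualResidual b x t θ ∈ vectorSpan ℝ (range x) :=
  sub_wMean_mem_vectorSpan (sum_tilt hb θ) ht

theorem tilt_starProjection (θ : EuclideanSpace ℝ (Fin K)) :
    tilt b x ((vectorSpan ℝ (range x)).starProjection θ) = tilt b x θ :=
  apply_starProjection_eq_of_forall_mem_orthogonal
    (fun y _ hd ↦ tilt_add_of_mem_orthogonal y hd) θ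

theorem dualResidual_starProjection (θ : EuclideanSpace ℝ (Fin K)) :
    dualResidual b x t ((vectorSpan ℝ (range x)).starProjection θ) = dualResidual b x t θ := by
  rw [dualResidual, dualResidual, tilt_starProjection]

theorem dualObj_starProjection [Nonempty (Fin N)] (hb : ∀ i, 0 < b i)
    (ht : t ∈ affineSpan ℝ (range x)) (θ : EuclideanSpace ℝ (Fin K)) :
    dualObj b x t ((vectorSpan ℝ (range x)).starProjection θ) = dualObj b x t θ :=
  apply_starProjection_eq_of_forall_mem_orthogonal
    (fun y _ hd ↦ dualObj_add_of_mem_orthogonal hb ht y hd) θ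

end Invariance

section Derivatives

theorem hasFDerivAt_inner_left (y θ : EuclideanSpace ℝ (Fin K)) :
    HasFDerivAt (fun θ : EuclideanSpace ℝ (Fin K) ↦ inner ℝ θ y) (innerSL ℝ y) θ := by
  simp_rw [real_inner_comm y]
  exact (innerSL ℝ y).hasFDerivAt

theorem hasFDerivAt_partitionFn [Nonempty (Fin N)] (hb : ∀ i, 0 < b i)
    (θ : EuclideanSpace ℝ (Fin K)) :
    HasFDerivAt (partitionFn b x) (partitionFn b x θ • innerSL ℝ (wMean (tilt b x θ) x)) θ := by
  have hZ := (partitionFn_pos (x := x) hb θ).ne'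
  refine (HasFDerivAt.fun_sum fun i _ ↦
    (hasFDerivAt_inner_left (x i) θ).exp.const_mul (b i)).congr_fderiv ?_
  simp only [wMean, tilt, map_sum, map_smul, Finset.smul_sum, smul_smul]
  refine Finset.sum_congr rfl fun i _ ↦ ?_
  congr 1
  field_simp

theorem hasGradientAt_dualObj [Nonempty (Fin N)] (hb : ∀ i, 0 < b i)
    (θ : EuclideanSpace ℝ (Fin K)) :
    HasGradientAt (dualObj b x t) (dualResidual b x t θ) θ := by
  have hZ := (partitionFn_pos (x := x) hb θ).ne'
  refine hasGradientAt_iff_hasFDerivAt.2 (((hasFDerivAt_inner_left t θ).sub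
    ((hasFDerivAt_partitionFn hb θ).log hZ)).congr_fderiv ?_)
  ext v
  simp [dualResidual, hZ]

theorem gradient_dualObj [Nonempty (Fin N)] (hb : ∀ i, 0 < b i) :
    ∇ (dualObj b x t) = dualResidual b x t :=
  gradient_eq (hasGradientAt_dualObj hb)

theorem hasFDerivAt_tilt [Nonempty (Fin N)] (hb : ∀ i, 0 < b i) (θ : EuclideanSpace ℝ (Fin K))
    (i : Fin N) :
    HasFDerivAt (fun θ ↦ tilt b x θ i)
      (tilt b x θ i • innerSL ℝ (x i - wMean (tilt b x θ) x)) θ := by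
  have hZ := (partitionFn_pos (x := x) hb θ).ne'
  refine (((hasFDerivAt_inner_left (x i) θ).exp.const_mul (b i)).mul
    ((hasDerivAt_inv hZ).comp_hasFDerivAt θ (hasFDerivAt_partitionFn hb θ))).congr_fderiv ?_
  ext v
  simp only [tilt, map_sub, _root_.add_apply, _root_.smul_apply, innerSL_apply_apply, smul_eq_mul,
    _root_.sub_apply, Function.comp_apply]
  field_simp
  ring

theorem hasFDerivAt_dualResidual [Nonempty (Fin N)] (hb : ∀ i, 0 < b i)
    (θ : EuclideanSpace ℝ (Fin K)) :
    HasFDerivAt (dualResidual b x t) (-covOperator (tilt b x θ) x) θ := by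
  have hmean : HasFDerivAt (fun θ ↦ wMean (tilt b x θ) x)
      (∑ i, (tilt b x θ i • innerSL ℝ (x i - wMean (tilt b x θ) x)).smulRight (x i)) θ :=
    HasFDerivAt.fun_sum fun i _ ↦ (hasFDerivAt_tilt hb θ i).smul_const (x i)
  refine (hmean.const_sub t).congr_fderiv ?_
  ext1 v
  have hcentred : ∑ i, tilt b x θ i * inner ℝ (x i - wMean (tilt b x θ) x) v = 0 := by
    simp only [inner_sub_left, mul_sub, Finset.sum_sub_distrib, ← Finset.sum_mul, sum_tilt hb,
      one_mul]
    simp [wMean, sum_inner, inner_smul_left]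
  simp only [_root_.neg_apply, _root_.sum_apply, ContinuousLinearMap.smulRight_apply,
    _root_.smul_apply, innerSL_apply_apply, smul_eq_mul, covOperator_apply, smul_sub,
    Finset.sum_sub_distrib, ← Finset.sum_smul, hcentred, zero_smul, sub_zero]

theorem fderiv_gradient_dualObj [Nonempty (Fin N)] (hb : ∀ i, 0 < b i) :
    fderiv ℝ (∇ (dualObj b x t)) = fun θ ↦ -covOperator (tilt b x θ) x := by
  rw [gradient_dualObj hb]
  exact funext fun θ ↦ (hasFDerivAt_dualResidual hb θ).fderiv

theorem continuous_dualObj [Nonempty (Fin N)] (hb : ∀ i, 0 < b i) :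
    Continuous (dualObj b x t) :=
  continuous_iff_continuousAt.2 fun θ ↦ (hasGradientAt_dualObj hb θ).continuousAt

theorem continuous_tilt [Nonempty (Fin N)] (hb : ∀ i, 0 < b i) : Continuous (tilt b x) :=
  continuous_pi fun i ↦ continuous_iff_continuousAt.2 fun θ ↦
    (hasFDerivAt_tilt hb θ i).continuousAt

theorem lipschitzWith_dualResidual [Nonempty (Fin N)] (hb : ∀ i, 0 < b i) :
    LipschitzWith (Real.toNNReal (Metric.diam (range x) ^ 2)) (dualResidual b x t) := by
  refine lipschitzWith_of_nnnorm_fderiv_le (𝕜 := ℝ)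
    (fun θ ↦ (hasFDerivAt_dualResidual hb θ).differentiableAt) fun θ ↦ ?_
  rw [(hasFDerivAt_dualResidual hb θ).fderiv, nnnorm_neg, ← norm_toNNReal]
  refine Real.toNNReal_le_toNNReal ?_
  exact norm_covOperator_le (fun i ↦ (tilt_pos hb θ i).le) (sum_tilt hb θ)

end Derivatives

section Maximizers

theorem isMaxOn_dualObj_iff_dualResidual_eq_zero [Nonempty (Fin N)] (hb : ∀ i, 0 < b i)
    {θ : EuclideanSpace ℝ (Fin K)} :
    IsMaxOn (dualObj b x t) univ θ ↔ dualResidual b x t θ = 0 := by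
  refine ⟨fun hθ ↦ ?_, fun hθ y _ ↦ ?_⟩
  · simpa using (hθ.isLocalMax univ_mem).hasFDerivAt_eq_zero
      (hasGradientAt_dualObj hb θ).hasFDerivAt
  · simpa [hθ] using dualObj_add_le (x := x) (t := t) hb θ (y - θ)

theorem isMaxOn_dualObj_iff_sub_mem_orthogonal [Nonempty (Fin N)] (hb : ∀ i, 0 < b i)
    (ht : t ∈ affineSpan ℝ (range x)) (hs : IsMaxOn (dualObj b x t) univ θs)
    {θ : EuclideanSpace ℝ (Fin K)} :
    IsMaxOn (dualObj b x t) univ θ ↔ θ - θs ∈ (vectorSpan ℝ (range x))ᗮ := by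
  refine ⟨fun hθ ↦ ?_, fun hd y hy ↦ ?_⟩
  · by_contra hd
    have hlt := dualObj_add_lt (t := t) hb θs hd
    rw [add_sub_cancel, (isMaxOn_dualObj_iff_dualResidual_eq_zero hb).1 hs, inner_zero_left,
      add_zero] at hlt
    exact hlt.not_ge (hθ (mem_univ θs))
  · have heq := dualObj_add_of_mem_orthogonal hb ht θs hd
    rw [add_sub_cancel] at heq
    exact (hs hy).trans_eq heq.symm

theorem starProjection_eq_of_isMaxOn_dualObj [Nonempty (Fin N)] (hb : ∀ i, 0 < b i)
    (ht : t ∈ affineSpan ℝ (range x)) (hs : IsMaxOn (dualObj b x t) univ θs)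
    {θ : EuclideanSpace ℝ (Fin K)} (hθ : IsMaxOn (dualObj b x t) univ θ) :
    (vectorSpan ℝ (range x)).starProjection θ = (vectorSpan ℝ (range x)).starProjection θs := by
  rw [← sub_eq_zero, ← map_sub, Submodule.starProjection_apply_eq_zero_iff]
  exact (isMaxOn_dualObj_iff_sub_mem_orthogonal hb ht hs).1 hθ

theorem exists_forall_dualObj_le_sub_mul_norm [Nonempty (Fin N)] (hb : ∀ i, 0 < b i)
    (ht : t ∈ intrinsicInterior ℝ (convexHull ℝ (range x))) :
    ∃ ε > 0, ∃ C, ∀ θ ∈ vectorSpan ℝ (range x), dualObj b x t θ ≤ C - ε * ‖θ‖ := by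
  obtain ⟨ε, hε, hx⟩ := exists_pos_forall_exists_add_mul_norm_le_inner ht
  obtain ⟨C, hC⟩ := Finite.exists_le fun i ↦ -Real.log (b i)
  refine ⟨ε, hε, C, fun θ hθ ↦ ?_⟩
  obtain ⟨i, hi⟩ := hx θ hθ
  have hlog : Real.log (b i) + inner ℝ θ (x i) ≤ Real.log (partitionFn b x θ) := by
    rw [← Real.log_exp (inner ℝ θ (x i)), ← Real.log_mul (hb i).ne' (Real.exp_pos _).ne']
    exact Real.log_le_log (mul_pos (hb i) (Real.exp_pos _)) (Finset.single_le_sum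
      (f := fun i ↦ b i * Real.exp (inner ℝ θ (x i)))
      (fun j _ ↦ (mul_pos (hb j) (Real.exp_pos _)).le) (Finset.mem_univ i))
  rw [dualObj]
  linarith [hC i]

theorem isCompact_setOf_le_dualObj [Nonempty (Fin N)] (hb : ∀ i, 0 < b i)
    (ht : t ∈ intrinsicInterior ℝ (convexHull ℝ (range x))) (l : ℝ) :
    IsCompact {θ | θ ∈ vectorSpan ℝ (range x) ∧ l ≤ dualObj b x t θ} := by
  obtain ⟨ε, hε, C, hC⟩ := exists_forall_dualObj_le_sub_mul_norm hb ht
  refine (isCompact_closedBall (0 : EuclideanSpace ℝ (Fin K)) ((C - l) / ε)).of_isClosed_subset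
    ((Submodule.closed_of_finiteDimensional _).inter
      (isClosed_le continuous_const (continuous_dualObj hb))) ?_
  rintro θ ⟨hθ, hl⟩
  rw [mem_closedBall_zero_iff, le_div_iff₀' hε]
  linarith [hC θ hθ]

theorem exists_isMaxOn_dualObj [Nonempty (Fin N)] (hb : ∀ i, 0 < b i)
    (ht : t ∈ intrinsicInterior ℝ (convexHull ℝ (range x))) :
    ∃ θs, IsMaxOn (dualObj b x t) univ θs := by
  have ht' := convexHull_subset_affineSpan _ (intrinsicInterior_subset ht)
  obtain ⟨θs, hθs, hs⟩ := (isCompact_setOf_le_dualObj hb ht (dualObj b x t 0)).exists_isMaxOn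
    ⟨0, zero_mem _, le_rfl⟩ (continuous_dualObj (x := x) (t := t) hb).continuousOn
  refine ⟨θs, fun y _ ↦ ?_⟩
  rcases le_total (dualObj b x t 0) (dualObj b x t y) with hy | hy
  · have hproj := dualObj_starProjection (x := x) hb ht' y
    exact hproj.symm.trans_le
      (hs ⟨Submodule.starProjection_apply_mem _ y, hy.trans_eq hproj.symm⟩)
  · exact hy.trans hθs.2

end Maximizers

end Tilting

/-! ### Newton directions -/

section NewtonDirection

variable {N K : ℕ} {b : Fin N → ℝ} {x : Fin N → EuclideanSpace ℝ (Fin K)}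
  {t θ Δ : EuclideanSpace ℝ (Fin K)} {δ c β α : ℝ}

theorem isNewtonDir_iff : IsNewtonDir b x t δ θ Δ ↔
    covOperator (tilt b x θ) x Δ + δ • Δ = dualResidual b x t θ := by
  rw [IsNewtonDir, toEuclideanLin_wCov_add_smul_one]

theorem IsNewtonDir.inner_eq (h : IsNewtonDir b x t δ θ Δ) :
    inner ℝ (dualResidual b x t θ) Δ =
      inner ℝ (covOperator (tilt b x θ) x Δ) Δ + δ * ‖Δ‖ ^ 2 := by
  rw [← isNewtonDir_iff.1 h, inner_add_left, real_inner_smul_left, real_inner_self_eq_norm_sq]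

variable [Nonempty (Fin N)]

theorem exists_isNewtonDir (hb : ∀ i, 0 < b i) (ht : t ∈ affineSpan ℝ (range x))
    (θ : EuclideanSpace ℝ (Fin K)) (hδ : 0 ≤ δ) : ∃ Δ, IsNewtonDir b x t δ θ Δ := by
  set T := (covOperator (tilt b x θ) x).toLinearMap + δ • LinearMap.id
  have hsymm : T.IsSymmetric :=
    isSymmetric_covOperator.add (LinearMap.IsSymmetric.id.smul (by simp))
  have hker : dualResidual b x t θ ∈ T.kerᗮ := by
    intro v hv
    have hquad : inner ℝ (covOperator (tilt b x θ) x v) v + δ * ‖v‖ ^ 2 = 0 := by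
      rw [← real_inner_self_eq_norm_sq, ← real_inner_smul_left, ← inner_add_left]
      exact (congrArg (inner ℝ · v) (LinearMap.mem_ker.1 hv)).trans (inner_zero_left v)
    have hnonpos : inner ℝ (covOperator (tilt b x θ) x v) v ≤ 0 := by
      linarith [mul_nonneg hδ (sq_nonneg ‖v‖)]
    exact Submodule.inner_left_of_mem_orthogonal (dualResidual_mem_vectorSpan hb ht θ)
      (mem_orthogonal_of_inner_covOperator_self_nonpos (tilt_pos hb θ) hnonpos)
  rw [← hsymm.orthogonal_range, Submodule.orthogonal_orthogonal] at hker
  obtain ⟨Δ, hΔ⟩ := hker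
  exact ⟨Δ, isNewtonDir_iff.2 hΔ⟩

theorem IsNewtonDir.inner_nonneg (hb : ∀ i, 0 < b i) (hδ : 0 ≤ δ)
    (h : IsNewtonDir b x t δ θ Δ) : 0 ≤ inner ℝ (dualResidual b x t θ) Δ := by
  rw [h.inner_eq]
  exact add_nonneg (inner_covOperator_self_nonneg (fun i ↦ (tilt_pos hb θ i).le) Δ) (by positivity)

theorem IsNewtonDir.exists_armijo (hb : ∀ i, 0 < b i) (ht : t ∈ affineSpan ℝ (range x))
    (hc : c < 1) (hβ₀ : 0 < β) (hβ₁ : β < 1) (hδ : 0 ≤ δ) (h : IsNewtonDir b x t δ θ Δ) :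
    ∃ j : ℕ, Armijo b x t c θ Δ (β ^ j) := by
  rcases (h.inner_nonneg hb hδ).eq_or_lt with hzero | hpos
  · have hΔ : Δ ∈ (vectorSpan ℝ (range x))ᗮ := by
      refine mem_orthogonal_of_inner_covOperator_self_nonpos (tilt_pos (x := x) hb θ) ?_
      linarith [h.inner_eq, mul_nonneg hδ (sq_nonneg ‖Δ‖)]
    refine ⟨0, ?_⟩
    rw [Armijo, ← hzero, mul_zero, add_zero, pow_zero, one_smul,
      dualObj_add_of_mem_orthogonal hb ht θ hΔ]
  · exact exists_sufficientIncrease_pow (hasGradientAt_dualObj hb θ) hpos hc hβ₀ hβ₁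

theorem IsNewtonDir.norm_dualResidual_le (hb : ∀ i, 0 < b i) (hδ : 0 ≤ δ)
    (h : IsNewtonDir b x t δ θ Δ) :
    ‖dualResidual b x t θ‖ ≤ (Metric.diam (range x) ^ 2 + δ) * ‖Δ‖ := by
  rw [← isNewtonDir_iff.1 h, add_mul]
  refine (norm_add_le _ _).trans (add_le_add ?_ (norm_smul_of_nonneg hδ Δ).le)
  exact ContinuousLinearMap.le_of_opNorm_le _
    (norm_covOperator_le (fun i ↦ (tilt_pos hb θ i).le) (sum_tilt hb θ)) Δ

theorem IsNewtonDir.starProjection (hb : ∀ i, 0 < b i) (ht : t ∈ affineSpan ℝ (range x))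
    (h : IsNewtonDir b x t δ θ Δ) :
    IsNewtonDir b x t δ ((vectorSpan ℝ (range x)).starProjection θ)
      ((vectorSpan ℝ (range x)).starProjection Δ) := by
  have hcov := apply_starProjection_eq_of_forall_mem_orthogonal
    (V := vectorSpan ℝ (range x)) (F := covOperator (tilt b x θ) x)
    (fun y d hd ↦ by
      rw [map_add, covOperator_apply_eq_zero_of_mem_orthogonal (sum_tilt hb θ) hd, add_zero]) Δ
  have hridge : δ • Δ ∈ vectorSpan ℝ (range x) := by
    rw [eq_sub_of_add_eq' (isNewtonDir_iff.1 h)]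
    exact sub_mem (dualResidual_mem_vectorSpan hb ht θ)
      (covOperator_apply_mem_vectorSpan (sum_tilt hb θ) Δ)
  rw [isNewtonDir_iff, tilt_starProjection, dualResidual_starProjection, hcov, ← map_smul,
    Submodule.starProjection_eq_self_iff.2 hridge]
  exact isNewtonDir_iff.1 h

theorem armijo_starProjection_iff (hb : ∀ i, 0 < b i) (ht : t ∈ affineSpan ℝ (range x)) :
    Armijo b x t c ((vectorSpan ℝ (range x)).starProjection θ)
      ((vectorSpan ℝ (range x)).starProjection Δ) α ↔ Armijo b x t c θ Δ α := by
  rw [Armijo, Armijo, ← map_smul, ← map_add, dualObj_starProjection hb ht,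
    dualObj_starProjection hb ht, dualResidual_starProjection,
    ← Submodule.inner_starProjection_left_eq_right,
    Submodule.starProjection_eq_self_iff.2 (dualResidual_mem_vectorSpan hb ht θ)]

end NewtonDirection

/-! ### Global convergence -/

section Global

variable {N K : ℕ} {b : Fin N → ℝ} {x : Fin N → EuclideanSpace ℝ (Fin K)}
  {t θs : EuclideanSpace ℝ (Fin K)} {c β δmax : ℝ} {δ : ℕ → ℝ}
  {θ Δ : ℕ → EuclideanSpace ℝ (Fin K)} {n : ℕ → ℕ}

theorem IsNewtonRun.isBacktrackingAscent (h : IsNewtonRun b x t c β δ θ Δ n) :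
    IsBacktrackingAscent (dualObj b x t) (dualResidual b x t) c β θ Δ n :=
  ⟨h.search, h.step⟩

theorem IsNewtonRun.backtracking_eq_zero (h : IsNewtonRun b x t c β δ θ Δ n) {k : ℕ}
    (hk : Armijo b x t c (θ k) (Δ k) 1) : n k = 0 ∧ θ (k + 1) = θ k + Δ k := by
  have hn : n k = 0 := Nat.le_zero.1 ((h.search k).2 (by simpa using hk))
  exact ⟨hn, by rw [h.step k, hn, pow_zero, one_smul]⟩

theorem IsNewtonRun.sub_starProjection_eq (h : IsNewtonRun b x t c β δ θ Δ n)
    (hΔ : ∀ k, Δ k ∈ vectorSpan ℝ (range x)) (k : ℕ) :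
    θ k - (vectorSpan ℝ (range x)).starProjection (θ k) =
      θ 0 - (vectorSpan ℝ (range x)).starProjection (θ 0) := by
  induction k with
  | zero => rfl
  | succ k ih =>
    rw [← ih, h.step k, map_add, map_smul, Submodule.starProjection_eq_self_iff.2 (hΔ k),
      add_sub_add_right_eq_sub]

variable [Nonempty (Fin N)]

theorem IsNewtonRun.monotone (hb : ∀ i, 0 < b i) (hc : 0 ≤ c) (hβ : 0 ≤ β) (hδ : ∀ k, 0 ≤ δ k)
    (h : IsNewtonRun b x t c β δ θ Δ n) : Monotone fun k ↦ dualObj b x t (θ k) :=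
  h.isBacktrackingAscent.monotone hc hβ fun k ↦ (h.dir k).inner_nonneg hb (hδ k)

theorem IsNewtonRun.starProjection (hb : ∀ i, 0 < b i) (ht : t ∈ affineSpan ℝ (range x))
    (h : IsNewtonRun b x t c β δ θ Δ n) :
    IsNewtonRun b x t c β δ (fun k ↦ (vectorSpan ℝ (range x)).starProjection (θ k))
      (fun k ↦ (vectorSpan ℝ (range x)).starProjection (Δ k)) n where
  dir k := (h.dir k).starProjection hb ht
  search k := by simpa only [armijo_starProjection_iff hb ht] using h.search k
  step k := by rw [h.step k, map_add, map_smul]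

theorem IsNewtonRun.exists_pos_forall_mul_sq_le_inner (hb : ∀ i, 0 < b i)
    {C : Set (EuclideanSpace ℝ (Fin K))} (hC : IsCompact C) (hδ : ∀ k, 0 ≤ δ k)
    (h : IsNewtonRun b x t c β δ θ Δ n) (hθ : ∀ k, θ k ∈ C)
    (hΔ : ∀ k, Δ k ∈ vectorSpan ℝ (range x)) :
    ∃ m > 0, ∀ k, m * ‖Δ k‖ ^ 2 ≤ inner ℝ (dualResidual b x t (θ k)) (Δ k) := by
  obtain ⟨m, hm, hcoercive⟩ := _root_.exists_pos_forall_mul_sq_le_inner hC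
    ((continuous_covOperator x).comp (continuous_tilt hb)).continuousOn (vectorSpan ℝ (range x))
    fun y _ v hv hv₀ ↦ inner_covOperator_self_pos (tilt_pos hb y) hv hv₀
  refine ⟨m, hm, fun k ↦ ?_⟩
  rw [(h.dir k).inner_eq]
  exact le_add_of_le_of_nonneg (hcoercive _ (hθ k) _ (hΔ k)) (mul_nonneg (hδ k) (sq_nonneg _))

theorem IsNewtonRun.tendsto_dualResidual_of_mem_vectorSpan (hb : ∀ i, 0 < b i)
    (ht : t ∈ intrinsicInterior ℝ (convexHull ℝ (range x))) (hc₀ : 0 < c) (hc₁ : c < 1)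
    (hβ : 0 < β) (hδ : ∀ k, 0 ≤ δ k ∧ δ k ≤ δmax) (h : IsNewtonRun b x t c β δ θ Δ n)
    (hθ : ∀ k, θ k ∈ vectorSpan ℝ (range x)) (hΔ : ∀ k, Δ k ∈ vectorSpan ℝ (range x)) :
    Tendsto (fun k ↦ dualResidual b x t (θ k)) atTop (𝓝 0) := by
  have hmono := h.monotone hb hc₀.le hβ.le fun k ↦ (hδ k).1
  obtain ⟨m, hm, hcoercive⟩ := h.exists_pos_forall_mul_sq_le_inner hb
    (isCompact_setOf_le_dualObj hb ht (dualObj b x t (θ 0))) (fun k ↦ (hδ k).1)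
    (fun k ↦ ⟨hθ k, hmono (Nat.zero_le k)⟩) hΔ
  obtain ⟨θs, hs⟩ := exists_isMaxOn_dualObj hb ht
  have hdirection : Tendsto Δ atTop (𝓝 0) := h.isBacktrackingAscent.tendsto_direction
    (hasGradientAt_dualObj hb) (lipschitzWith_dualResidual hb) hc₀ hc₁ hβ hm hcoercive
    ⟨_, forall_mem_range.2 fun k ↦ hs (mem_univ (θ k))⟩
  refine squeeze_zero_norm (fun k ↦ ?_)
    (by simpa using hdirection.norm.const_mul (Metric.diam (range x) ^ 2 + δmax))
  refine ((h.dir k).norm_dualResidual_le hb (hδ k).1).trans ?_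
  gcongr
  exact (hδ k).2

theorem tendsto_starProjection_of_tendsto_dualResidual (hb : ∀ i, 0 < b i)
    (ht : t ∈ intrinsicInterior ℝ (convexHull ℝ (range x))) {u : ℕ → EuclideanSpace ℝ (Fin K)}
    (hu : ∀ k, u k ∈ vectorSpan ℝ (range x)) {l : ℝ} (hl : ∀ k, l ≤ dualObj b x t (u k))
    (hzero : Tendsto (fun k ↦ dualResidual b x t (u k)) atTop (𝓝 0))
    (hs : IsMaxOn (dualObj b x t) univ θs) :
    Tendsto u atTop (𝓝 ((vectorSpan ℝ (range x)).starProjection θs)) := by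
  have ht' := convexHull_subset_affineSpan _ (intrinsicInterior_subset ht)
  refine (isCompact_setOf_le_dualObj hb ht l).tendsto_nhds_of_unique_mapClusterPt
    (Eventually.of_forall fun k ↦ ⟨hu k, hl k⟩) fun y hy hcluster ↦ ?_
  obtain ⟨ψ, hψ, hlim⟩ := hcluster.tendsto_subseq
  have hy_zero : dualResidual b x t y = 0 := tendsto_nhds_unique
    (((lipschitzWith_dualResidual hb).continuous.tendsto y).comp hlim)
    (hzero.comp hψ.tendsto_atTop)
  rw [← starProjection_eq_of_isMaxOn_dualObj hb ht' hs
    ((isMaxOn_dualObj_iff_dualResidual_eq_zero hb).2 hy_zero),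
    Submodule.starProjection_eq_self_iff.2 hy.1]

theorem IsNewtonRun.tendsto_starProjection (hb : ∀ i, 0 < b i)
    (ht : t ∈ intrinsicInterior ℝ (convexHull ℝ (range x))) (hc₀ : 0 < c) (hc₁ : c < 1)
    (hβ : 0 < β) (hδ : ∀ k, 0 ≤ δ k ∧ δ k ≤ δmax) (h : IsNewtonRun b x t c β δ θ Δ n)
    (hs : IsMaxOn (dualObj b x t) univ θs) :
    Tendsto (fun k ↦ (vectorSpan ℝ (range x)).starProjection (θ k)) atTop
      (𝓝 ((vectorSpan ℝ (range x)).starProjection θs)) := by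
  have hproj := h.starProjection hb (convexHull_subset_affineSpan _ (intrinsicInterior_subset ht))
  have hmem : ∀ y, (vectorSpan ℝ (range x)).starProjection y ∈ vectorSpan ℝ (range x) :=
    Submodule.starProjection_apply_mem _
  exact tendsto_starProjection_of_tendsto_dualResidual hb ht (fun k ↦ hmem (θ k))
    (fun k ↦ hproj.monotone hb hc₀.le hβ.le (fun k ↦ (hδ k).1) (Nat.zero_le k))
    (hproj.tendsto_dualResidual_of_mem_vectorSpan hb ht hc₀ hc₁ hβ hδ (fun k ↦ hmem (θ k))
      fun k ↦ hmem (Δ k)) hs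

theorem tendsto_dualResidual_of_tendsto_starProjection (hb : ∀ i, 0 < b i)
    (hs : IsMaxOn (dualObj b x t) univ θs)
    (hlim : Tendsto (fun k ↦ (vectorSpan ℝ (range x)).starProjection (θ k)) atTop
      (𝓝 ((vectorSpan ℝ (range x)).starProjection θs))) :
    Tendsto (fun k ↦ dualResidual b x t (θ k)) atTop (𝓝 0) := by
  rw [← (isMaxOn_dualObj_iff_dualResidual_eq_zero hb).1 hs]
  exact tendsto_comp_of_tendsto_starProjection (lipschitzWith_dualResidual hb).continuous
    dualResidual_starProjection hlim

theorem isMaxOn_dualObj_add_sub_starProjection (hb : ∀ i, 0 < b i)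
    (ht : t ∈ affineSpan ℝ (range x)) (hs : IsMaxOn (dualObj b x t) univ θs)
    (y : EuclideanSpace ℝ (Fin K)) :
    IsMaxOn (dualObj b x t) univ
      ((vectorSpan ℝ (range x)).starProjection θs +
        (y - (vectorSpan ℝ (range x)).starProjection y)) := by
  refine (isMaxOn_dualObj_iff_sub_mem_orthogonal hb ht hs).2 ?_
  rw [add_sub_right_comm, ← neg_sub θs]
  exact add_mem (neg_mem (Submodule.sub_starProjection_mem_orthogonal θs))
    (Submodule.sub_starProjection_mem_orthogonal y)

theorem tendsto_infDist_setOf_isMaxOn_dualObj (hb : ∀ i, 0 < b i)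
    (ht : t ∈ affineSpan ℝ (range x)) (hs : IsMaxOn (dualObj b x t) univ θs)
    (hlim : Tendsto (fun k ↦ (vectorSpan ℝ (range x)).starProjection (θ k)) atTop
      (𝓝 ((vectorSpan ℝ (range x)).starProjection θs))) :
    Tendsto (fun k ↦ Metric.infDist (θ k) {θs | IsMaxOn (dualObj b x t) univ θs}) atTop (𝓝 0) := by
  refine squeeze_zero (fun k ↦ Metric.infDist_nonneg) (fun k ↦ ?_)
    (tendsto_iff_dist_tendsto_zero.1 hlim)
  refine (Metric.infDist_le_dist_of_mem (s := {θs | IsMaxOn (dualObj b x t) univ θs})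
    (isMaxOn_dualObj_add_sub_starProjection hb ht hs (θ k))).trans_eq ?_
  rw [dist_eq_norm, dist_eq_norm]
  congr 1
  abel

theorem IsNewtonRun.exists_isMaxOn_tendsto (hb : ∀ i, 0 < b i)
    (ht : t ∈ affineSpan ℝ (range x)) (h : IsNewtonRun b x t c β δ θ Δ n)
    (hΔ : ∀ k, Δ k ∈ LinearMap.range (Matrix.toEuclideanLin (wCov (tilt b x (θ k)) x)))
    (hs : IsMaxOn (dualObj b x t) univ θs)
    (hlim : Tendsto (fun k ↦ (vectorSpan ℝ (range x)).starProjection (θ k)) atTop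
      (𝓝 ((vectorSpan ℝ (range x)).starProjection θs))) :
    ∃ θs, IsMaxOn (dualObj b x t) univ θs ∧ Tendsto θ atTop (𝓝 θs) := by
  have hΔV : ∀ k, Δ k ∈ vectorSpan ℝ (range x) := fun k ↦ by
    obtain ⟨v, hv⟩ := hΔ k
    exact hv ▸ covOperator_apply_mem_vectorSpan (sum_tilt hb (θ k)) v
  refine ⟨_, isMaxOn_dualObj_add_sub_starProjection hb ht hs (θ 0), (hlim.add_const _).congr
    fun k ↦ ?_⟩
  rw [← h.sub_starProjection_eq hΔV k, add_sub_cancel]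

end Global

/-! ### Local quadratic convergence -/

section Local

variable {N K : ℕ} [Nonempty (Fin N)] {b : Fin N → ℝ} {x : Fin N → EuclideanSpace ℝ (Fin K)}
  {t θs : EuclideanSpace ℝ (Fin K)} {c β m : ℝ} {M : ℝ≥0} {U : Set (EuclideanSpace ℝ (Fin K))}

theorem vectorSpan_eq_top_of_posSemidef (hb : ∀ i, 0 < b i) (hm : 0 < m)
    (hpos : (wCov (tilt b x θs) x - m • (1 : Matrix (Fin K) (Fin K) ℝ)).PosSemidef) :
    vectorSpan ℝ (range x) = ⊤ := by
  refine Submodule.orthogonal_eq_bot_iff.1 ((Submodule.eq_bot_iff _).2 fun v hv ↦ ?_)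
  have hcoercive := mul_norm_sq_le_inner_covOperator_of_posSemidef hpos v
  rw [covOperator_apply_eq_zero_of_mem_orthogonal (sum_tilt hb θs) hv, inner_zero_left] at hcoercive
  simpa using (nonpos_of_mul_nonpos_right hcoercive hm).antisymm (sq_nonneg _)

theorem exists_radius_newtonRun_step (hb : ∀ i, 0 < b i) (hc : c < 1 / 2)
    (hs : IsMaxOn (dualObj b x t) univ θs) (hm : 0 < m) (hU : U ∈ 𝓝 θs)
    (hpos : ∀ θ ∈ U, (wCov (tilt b x θ) x - m • (1 : Matrix (Fin K) (Fin K) ℝ)).PosSemidef)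
    (hM : LipschitzOnWith M (fderiv ℝ (∇ (dualObj b x t))) U) :
    ∃ r > 0, ∀ {δ : ℕ → ℝ} {θ Δ : ℕ → EuclideanSpace ℝ (Fin K)} {n : ℕ → ℕ},
      IsNewtonRun b x t c β δ θ Δ n → ∀ k, δ k = 0 → ‖θ k - θs‖ < r →
      (n k = 0 ∧ ‖θ (k + 1) - θs‖ ≤ M / (2 * m) * ‖θ k - θs‖ ^ 2) ∧
        ‖θ (k + 1) - θs‖ ≤ 1 / 2 * ‖θ k - θs‖ := by
  rw [fderiv_gradient_dualObj hb] at hM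
  obtain ⟨r, hr, hstep⟩ := exists_radius_newton_step hU (fun y _ ↦ hasGradientAt_dualObj hb y)
    (fun y _ ↦ hasFDerivAt_dualResidual hb y) hM hm
    (fun y hy v ↦ by
      simpa using mul_norm_sq_le_inner_covOperator_of_posSemidef (hpos y hy) v)
    ((isMaxOn_dualObj_iff_dualResidual_eq_zero hb).1 hs) hc
  refine ⟨r, hr, fun {δ θ Δ n} h k hδ hθ ↦ ?_⟩
  have hnewton : (-covOperator (tilt b x (θ k)) x) (Δ k) = -dualResidual b x t (θ k) := by
    rw [← isNewtonDir_iff.1 (h.dir k), hδ, zero_smul, add_zero, _root_.neg_apply]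
  obtain ⟨hincrease, hquadratic, hcontraction⟩ := hstep (θ k) (Δ k) hθ hnewton
  obtain ⟨hn, hsucc⟩ := h.backtracking_eq_zero hincrease
  rw [hsucc]
  exact ⟨⟨hn, hquadratic⟩, hcontraction⟩

theorem exists_radius_newtonRun_tendsto (hb : ∀ i, 0 < b i) (hc : c < 1 / 2)
    (hs : IsMaxOn (dualObj b x t) univ θs) (hm : 0 < m) (hU : U ∈ 𝓝 θs)
    (hpos : ∀ θ ∈ U, (wCov (tilt b x θ) x - m • (1 : Matrix (Fin K) (Fin K) ℝ)).PosSemidef)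
    (hM : LipschitzOnWith M (fderiv ℝ (∇ (dualObj b x t))) U) :
    ∃ r > 0, ∀ (θ Δ : ℕ → EuclideanSpace ℝ (Fin K)) (n : ℕ → ℕ),
      IsNewtonRun b x t c β (fun _ ↦ 0) θ Δ n → ‖θ 0 - θs‖ < r → Tendsto θ atTop (𝓝 θs) ∧
        ∀ k, n k = 0 ∧ ‖θ (k + 1) - θs‖ ≤ M / (2 * m) * ‖θ k - θs‖ ^ 2 := by
  obtain ⟨r, hr, hstep⟩ := exists_radius_newtonRun_step (β := β) hb hc hs hm hU hpos hM
  simp only [← dist_eq_norm] at hstep ⊢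
  refine ⟨r, hr, fun θ Δ n h hθ ↦ ?_⟩
  obtain ⟨hball, hlim⟩ := tendsto_of_dist_succ_le (by norm_num) one_half_lt_one hθ
    fun k hk ↦ (hstep h k rfl hk).2
  exact ⟨hlim, fun k ↦ (hstep h k rfl (hball k)).1⟩

theorem IsNewtonRun.tendsto_and_eventually_quadratic {δmax : ℝ} {δ : ℕ → ℝ}
    {θ Δ : ℕ → EuclideanSpace ℝ (Fin K)} {n : ℕ → ℕ} (hb : ∀ i, 0 < b i)
    (ht : t ∈ intrinsicInterior ℝ (convexHull ℝ (range x))) (hc₀ : 0 < c) (hc : c < 1 / 2)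
    (hβ : 0 < β) (hs : IsMaxOn (dualObj b x t) univ θs) (hm : 0 < m) (hU : U ∈ 𝓝 θs)
    (hpos : ∀ θ ∈ U, (wCov (tilt b x θ) x - m • (1 : Matrix (Fin K) (Fin K) ℝ)).PosSemidef)
    (hM : LipschitzOnWith M (fderiv ℝ (∇ (dualObj b x t))) U)
    (hδ : ∀ k, 0 ≤ δ k ∧ δ k ≤ δmax) (hδ₀ : ∀ᶠ k in atTop, δ k = 0)
    (h : IsNewtonRun b x t c β δ θ Δ n) :
    Tendsto θ atTop (𝓝 θs) ∧
      ∀ᶠ k in atTop, n k = 0 ∧ ‖θ (k + 1) - θs‖ ≤ M / (2 * m) * ‖θ k - θs‖ ^ 2 := by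
  obtain ⟨r, hr, hstep⟩ := exists_radius_newtonRun_step hb hc hs hm hU hpos hM
  have hlim : Tendsto θ atTop (𝓝 θs) := by
    simpa only [vectorSpan_eq_top_of_posSemidef hb hm (hpos θs (mem_of_mem_nhds hU)),
      Submodule.starProjection_top, ContinuousLinearMap.id_apply] using
      h.tendsto_starProjection hb ht hc₀ (hc.trans one_half_lt_one) hβ hδ hs
  refine ⟨hlim, ?_⟩
  filter_upwards [hδ₀, (tendsto_iff_norm_sub_tendsto_zero.1 hlim).eventually_lt_const hr]
    with k hk hθ using (hstep h k hk hθ).1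

end Local

theorem mainTheorem4_general {N K : ℕ} (b : Fin N → ℝ) (hb : ∀ i, 0 < b i)
    (x : Fin N → EuclideanSpace ℝ (Fin K)) (t : EuclideanSpace ℝ (Fin K))
    (ht : t ∈ intrinsicInterior ℝ (convexHull ℝ (range x)))
    (c β : ℝ) (hc0 : 0 < c) (hc1 : c < 1) (hβ0 : 0 < β) (hβ1 : β < 1) :
    (∃ θs, IsMaxOn (dualObj b x t) univ θs) ∧
    (∀ (θ : EuclideanSpace ℝ (Fin K)) (δ : ℝ), 0 ≤ δ →
      (∃ Δ, IsNewtonDir b x t δ θ Δ) ∧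
      ∀ Δ, IsNewtonDir b x t δ θ Δ → ∃ j : ℕ, Armijo b x t c θ Δ (β ^ j)) ∧
    (∀ (δmax : ℝ) (δ : ℕ → ℝ) (θ Δ : ℕ → EuclideanSpace ℝ (Fin K)) (n : ℕ → ℕ),
      (∀ k, 0 ≤ δ k ∧ δ k ≤ δmax) → IsNewtonRun b x t c β δ θ Δ n →
      Monotone (fun k ↦ dualObj b x t (θ k)) ∧
      Tendsto (fun k ↦ ∇ (dualObj b x t) (θ k)) atTop (𝓝 0) ∧
      Tendsto (fun k ↦ wMean (tilt b x (θ k)) x) atTop (𝓝 t) ∧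
      (∀ θs, IsMaxOn (dualObj b x t) univ θs →
        Tendsto (fun k ↦ dualObj b x t (θ k)) atTop (𝓝 (dualObj b x t θs)) ∧
        Tendsto (fun k ↦ tilt b x (θ k)) atTop (𝓝 (tilt b x θs))) ∧
      Tendsto (fun k ↦ Metric.infDist (θ k) {θs | IsMaxOn (dualObj b x t) univ θs})
        atTop (𝓝 0) ∧
      ((∀ k, Δ k ∈ LinearMap.range (Matrix.toEuclideanLin (wCov (tilt b x (θ k)) x))) →
        ∃ θs, IsMaxOn (dualObj b x t) univ θs ∧ Tendsto θ atTop (𝓝 θs))) ∧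
    (c < 1 / 2 → ∀ (θs : EuclideanSpace ℝ (Fin K)), IsMaxOn (dualObj b x t) univ θs →
      ∀ (m : ℝ) (M : ℝ≥0) (U : Set (EuclideanSpace ℝ (Fin K))), 0 < m → U ∈ 𝓝 θs →
      (∀ θ ∈ U, (wCov (tilt b x θ) x - m • (1 : Matrix (Fin K) (Fin K) ℝ)).PosSemidef) →
      LipschitzOnWith M (fderiv ℝ (∇ (dualObj b x t))) U →
      (∃ r : ℝ, 0 < r ∧
        ∀ (θ Δ : ℕ → EuclideanSpace ℝ (Fin K)) (n : ℕ → ℕ),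
          IsNewtonRun b x t c β (fun _ ↦ 0) θ Δ n → ‖θ 0 - θs‖ < r →
          Tendsto θ atTop (𝓝 θs) ∧
          ∀ k, n k = 0 ∧ ‖θ (k + 1) - θs‖ ≤ (M : ℝ) / (2 * m) * ‖θ k - θs‖ ^ 2) ∧
      (∀ (δmax : ℝ) (δ : ℕ → ℝ) (θ Δ : ℕ → EuclideanSpace ℝ (Fin K)) (n : ℕ → ℕ),
        (∀ k, 0 ≤ δ k ∧ δ k ≤ δmax) → (∀ᶠ k in atTop, δ k = 0) →
        IsNewtonRun b x t c β δ θ Δ n →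
        Tendsto θ atTop (𝓝 θs) ∧
        ∀ᶠ k in atTop, n k = 0 ∧
          ‖θ (k + 1) - θs‖ ≤ (M : ℝ) / (2 * m) * ‖θ k - θs‖ ^ 2)) := by
  have : Nonempty (Fin N) := range_nonempty_iff_nonempty.1
    (convexHull_nonempty_iff.1 ⟨t, intrinsicInterior_subset ht⟩)
  have ht' := convexHull_subset_affineSpan _ (intrinsicInterior_subset ht)
  obtain ⟨θp, hp⟩ := exists_isMaxOn_dualObj hb ht
  refine ⟨⟨θp, hp⟩, fun θ δ hδ ↦ ⟨exists_isNewtonDir hb ht' θ hδ, fun Δ h ↦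
    h.exists_armijo hb ht' hc1 hβ0 hβ1 hδ⟩, fun δmax δ θ Δ n hδ h ↦ ?_,
    fun hc θs hs m M U hm hU hpos hM ↦ ⟨?_, fun δmax δ θ Δ n hδ hδ₀ h ↦ ?_⟩⟩
  · have hlim := fun {θs} ↦ h.tendsto_starProjection (θs := θs) hb ht hc0 hc1 hβ0 hδ
    have hresidual := tendsto_dualResidual_of_tendsto_starProjection hb hp (hlim hp)
    refine ⟨h.monotone hb hc0.le hβ0.le fun k ↦ (hδ k).1, by rwa [gradient_dualObj hb],
      by simpa [dualResidual] using hresidual.const_sub t, fun θs hs ↦ ⟨?_, ?_⟩,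
      tendsto_infDist_setOf_isMaxOn_dualObj hb ht' hp (hlim hp),
      fun hΔ ↦ h.exists_isMaxOn_tendsto hb ht' hΔ hp (hlim hp)⟩
    · exact tendsto_comp_of_tendsto_starProjection (continuous_dualObj hb)
        (dualObj_starProjection hb ht') (hlim hs)
    · exact tendsto_comp_of_tendsto_starProjection (continuous_tilt hb) tilt_starProjection
        (hlim hs)
  · exact exists_radius_newtonRun_tendsto hb hc hs hm hU hpos hM
  · exact h.tendsto_and_eventually_quadratic hb ht hc0 hc hβ0 hs hm hU hpos hM hδ hδ₀

theorem mainTheorem4 {N K : ℕ} (b : Fin N → ℝ) (hb : ∀ i, 0 < b i)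
    (hb1 : ∑ i, b i = 1)
    (x : Fin N → EuclideanSpace ℝ (Fin K)) (t : EuclideanSpace ℝ (Fin K))
    (ht : t ∈ intrinsicInterior ℝ (convexHull ℝ (range x)))
    (c β : ℝ) (hc0 : 0 < c) (hc1 : c < 1 / 2) (hβ0 : 0 < β) (hβ1 : β < 1) :
    -- the dual objective attains its maximum
    (∃ θs, IsMaxOn (dualObj b x t) univ θs) ∧
    -- every step of the method is well defined
    (∀ (θ : EuclideanSpace ℝ (Fin K)) (δ : ℝ), 0 ≤ δ →
      (∃ Δ, IsNewtonDir b x t δ θ Δ) ∧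
      ∀ Δ, IsNewtonDir b x t δ θ Δ → ∃ j : ℕ, Armijo b x t c θ Δ (β ^ j)) ∧
    -- global convergence, from an arbitrary starting point
    (∀ (δmax : ℝ) (δ : ℕ → ℝ) (θ Δ : ℕ → EuclideanSpace ℝ (Fin K)) (n : ℕ → ℕ),
      (∀ k, 0 ≤ δ k ∧ δ k ≤ δmax) → IsNewtonRun b x t c β δ θ Δ n →
      Monotone (fun k => dualObj b x t (θ k)) ∧
      Tendsto (fun k => ∇ (dualObj b x t) (θ k)) atTop (𝓝 0) ∧
      Tendsto (fun k => wMean (tilt b x (θ k)) x) atTop (𝓝 t) ∧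
      (∀ θs, IsMaxOn (dualObj b x t) univ θs →
        Tendsto (fun k => dualObj b x t (θ k)) atTop (𝓝 (dualObj b x t θs)) ∧
        Tendsto (fun k => tilt b x (θ k)) atTop (𝓝 (tilt b x θs))) ∧
      Tendsto (fun k => Metric.infDist (θ k) {θs | IsMaxOn (dualObj b x t) univ θs})
        atTop (𝓝 0) ∧
      ((∀ k, Δ k ∈ LinearMap.range (Matrix.toEuclideanLin (wCov (tilt b x (θ k)) x))) →
        ∃ θs, IsMaxOn (dualObj b x t) univ θs ∧ Tendsto θ atTop (𝓝 θs))) ∧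
    -- local quadratic convergence of the pure Newton iteration
    (∀ (θs : EuclideanSpace ℝ (Fin K)), IsMaxOn (dualObj b x t) univ θs →
      ∀ (m : ℝ) (M : ℝ≥0) (U : Set (EuclideanSpace ℝ (Fin K))), 0 < m → U ∈ 𝓝 θs →
      (∀ θ ∈ U, (wCov (tilt b x θ) x - m • (1 : Matrix (Fin K) (Fin K) ℝ)).PosSemidef) →
      LipschitzOnWith M (fderiv ℝ (∇ (dualObj b x t))) U →
      (∃ r : ℝ, 0 < r ∧
        ∀ (θ Δ : ℕ → EuclideanSpace ℝ (Fin K)) (n : ℕ → ℕ),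
          IsNewtonRun b x t c β (fun _ => 0) θ Δ n → ‖θ 0 - θs‖ < r →
          Tendsto θ atTop (𝓝 θs) ∧
          ∀ k, n k = 0 ∧ ‖θ (k + 1) - θs‖ ≤ (M : ℝ) / (2 * m) * ‖θ k - θs‖ ^ 2) ∧
      (∀ (δmax : ℝ) (δ : ℕ → ℝ) (θ Δ : ℕ → EuclideanSpace ℝ (Fin K)) (n : ℕ → ℕ),
        (∀ k, 0 ≤ δ k ∧ δ k ≤ δmax) → (∀ᶠ k in atTop, δ k = 0) →
        IsNewtonRun b x t c β δ θ Δ n →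
        Tendsto θ atTop (𝓝 θs) ∧
        ∀ᶠ k in atTop, n k = 0 ∧
          ‖θ (k + 1) - θs‖ ≤ (M : ℝ) / (2 * m) * ‖θ k - θs‖ ^ 2)) := by
  obtain ⟨hmax, hwell, hglobal, hlocal⟩ :=
    mainTheorem4_general b hb x t ht c β hc0 (hc1.trans one_half_lt_one) hβ0 hβ1
  exact ⟨hmax, hwell, hglobal, hlocal hc1⟩
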